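/- Let $\beta_1,\beta_2>1$. An Evader $E$ and two Pursuers $P_1,P_2$ move in the plane by $\dot{\mathbf x}_E=(\cos\phi,\sin\phi)$, $\dot{\mathbf x}_{P_i}=\beta_i(\cos\psi_i,\sin\psi_i)$, where the headings $\phi$ (chosen by $E$) and $\psi_1,\psi_2$ (chosen by the Pursuers) are measurable in time and the equations hold in integrated form. The game ends at the first time at which $\mathbf x_{P_1}=\mathbf x_E$ or $\mathbf x_{P_2}=\mathbf x_E$ (capture); the Pursuers minimize and $E$ maximizes this time. For a state $\mathbf x$ before capture let $\lambda_i$ be the angle of the vector $\mathbf x_E-\mathbf x_{P_i}$, $r_i=|\mathbf x_E-\mathbf x_{P_i}|$, $c_i=r_i/(\beta_i^2-1)$, $\rho_i=\beta_i r_i/(\beta_i^2-1)$, $$t_{f_i}(\phi)=c_i\cos(\phi-\lambda_i)+\sqrt{c_i^2\cos^2(\phi-\lambda_i)+c_ir_i},$$ and let the $i$-th Apollonius circle be the circle with center $\mathbf x_E+c_i(\cos\lambda_i,\sin\lambda_i)$ and radius $\rho_i$. Consider the following state feedback (headings are taken modulo $2\pi$): 1. if $t_{f_1}(\lambda_1)\le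 t_{f_2}(\lambda_1)$, then $\phi^*=\psi_1^*=\lambda_1$; 2. if $t_{f_2}(\lambda_2)\le t_{f_1}(\lambda_2)$, then $\phi^*=\psi_2^*=\lambda_2$; 3. otherwise $\phi^*,\psi_1^*,\psi_2^*$ are the angles of $I-\mathbf x_E$, $I-\mathbf x_{P_1}$, $I-\mathbf x_{P_2}$, where $I$ is an intersection point of the two Apollonius circles that is farthest from $\mathbf x_E$ (if both intersection points are equally far, both choices are allowed, and the Evader and the team of Pursuers may choose differently). A heading that is not specified (that of the other Pursuer when only 1 or only 2 applies) is arbitrary. Then, for every initial state before capture: (a) In case 3 the two circles meet in exactly two points. The cases are consistent, that is, headings $(\phi^*,\psi_1^*,\psi_2^*)$ that satisfy all the applicable requirements exist (in case 3 with the same $I$ for all players). (b) Let $V=t_{f_1}(\lambda_1)$ in case 1, $V=t_{f_2}(\lambda_2)$ in case 2, and $V=|I-\mathbf x_E|=t_{f_1}(\phi^*)=t_{f_2}(\phi^*)$ in case 3, evaluated at the initial state; then $V$ is well defined and $V>0$. The feedback is a saddle point with capture time $V$: in every motion (defined at least up to time $V$) in which the Pursuers use their feedback at almost every time before capture, and the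 Evader plays arbitrarily, capture occurs no later than $V$; in every motion in which the Evader uses its feedback at almost every time before capture, and the Pursuers play arbitrarily, capture does not occur before $V$. (c) If all players hold constant the headings $(\phi^*,\psi_1^*,\psi_2^*)$ of the initial state (with the same $I$ for all players in case 3), then these headings agree with the feedback at all times $t\in[0,V)$, no capture occurs before $V$, and at time $V$ the Evader is captured by $P_1$ in case 1, by $P_2$ in case 2, and simultaneously by both Pursuers at the point $I$ in case 3. -/

import Mathlib

open MeasureTheory Set

noncomputable section

namespace TwoCutters

/-- State of the game in the realistic plane, which is identified with `ℂ` (a point `(x, y)` is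
`x + i y`, and the norm of `ℂ` is the Euclidean norm): the position of the Evader and the positions
of the two Pursuers `P₁`, `P₂`, which carry the indices `0`, `1`. -/
structure State where
  E : ℂ
  P : Fin 2 → ℂ

/-- The unit vector `(cos θ, sin θ)` of the heading angle `θ`. -/
def heading (θ : ℝ) : ℂ := ⟨Real.cos θ, Real.sin θ⟩

/-- Terminal condition: point capture of the Evader by at least one Pursuer. -/
def Captured (x : State) : Prop := ∃ i, x.P i = x.E

/-- `x` is the motion on `[0, T]`, from the initial state `x₀`, that is produced by the measurable
heading signals `φ` (Evader, speed `1`) and `ψ i` (Pursuers, speeds `β i`): the integrated form of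
`ẋ_E = (cos φ, sin φ)`, `ẋ_{P_i} = β_i (cos ψ_i, sin ψ_i)`. -/
structure IsPlay (β : Fin 2 → ℝ) (x₀ : State) (T : ℝ) (x : ℝ → State)
    (φ : ℝ → ℝ) (ψ : Fin 2 → ℝ → ℝ) : Prop where
  measurable_evader : Measurable φ
  measurable_pursuer : ∀ i, Measurable (ψ i)
  evader : ∀ t ∈ Icc 0 T, (x t).E = x₀.E + ∫ s in (0 : ℝ)..t, heading (φ s)
  pursuer : ∀ i, ∀ t ∈ Icc 0 T,
    (x t).P i = x₀.P i + ∫ s in (0 : ℝ)..t, β i • heading (ψ i s)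

/-- Line-of-sight angle `λ_i` from `P_i` to `E` (the four-quadrant arctangent). -/
def los (x : State) (i : Fin 2) : ℝ := Complex.arg (x.E - x.P i)

/-- Distance `r_i` between `E` and `P_i`. -/
def r (x : State) (i : Fin 2) : ℝ := ‖x.E - x.P i‖

/-- `c_i = r_i / (β_i² - 1)`. -/
def c (β : Fin 2 → ℝ) (x : State) (i : Fin 2) : ℝ := r x i / (β i ^ 2 - 1)

/-- `ρ_i = β_i r_i / (β_i² - 1)`. -/
def ρ (β : Fin 2 → ℝ) (x : State) (i : Fin 2) : ℝ := β i * r x i / (β i ^ 2 - 1)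

/-- `t_{f_i}(φ)`, the time in which `P_i` intercepts the Evader that holds the heading `φ`. -/
def tf (β : Fin 2 → ℝ) (x : State) (i : Fin 2) (φ : ℝ) : ℝ :=
  c β x i * Real.cos (φ - los x i)
    + Real.sqrt (c β x i ^ 2 * Real.cos (φ - los x i) ^ 2 + c β x i * r x i)

/-- Apollonius circle of `E` and `P_i`: its center lies at distance `c_i` from `E` in the direction
`λ_i`, and its radius is `ρ_i`. -/
def apollonius (β : Fin 2 → ℝ) (x : State) (i : Fin 2) : Set ℂ :=
  Metric.sphere (x.E + c β x i • heading (los x i)) (ρ β x i)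

/-- The intersection points of the two Apollonius circles that are farthest from `E`. There are
two of them exactly when the two intersection points are equally far from `E`. -/
def aimPoints (β : Fin 2 → ℝ) (x : State) : Set ℂ :=
  {I | I ∈ apollonius β x 0 ∩ apollonius β x 1 ∧
    ∀ J ∈ apollonius β x 0 ∩ apollonius β x 1, dist J x.E ≤ dist I x.E}

/-- `t_{f_i}(λ_i) ≤ t_{f_j}(λ_i)`, where `P_j` is the Pursuer other than `P_i`. -/
def SinglePursuerCase (β : Fin 2 → ℝ) (x : State) (i : Fin 2) : Prop :=
  ∀ j, j ≠ i → tf β x i (los x i) ≤ tf β x j (los x i)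

/-- The remaining case: `SinglePursuerCase` holds for neither Pursuer. -/
def JointCase (β : Fin 2 → ℝ) (x : State) : Prop := ∀ i, ¬ SinglePursuerCase β x i

/-- The state feedback of the Evader: `φ` is a heading that it prescribes in the state `x`.
Headings are compared modulo `2π`. -/
def EvaderOptimal (β : Fin 2 → ℝ) (x : State) (φ : ℝ) : Prop :=
  (∀ i, SinglePursuerCase β x i → (φ : Real.Angle) = (los x i : Real.Angle)) ∧
  (JointCase β x → ∃ I ∈ aimPoints β x,
    (φ : Real.Angle) = (Complex.arg (I - x.E) : Real.Angle))

/-- The state feedback of the team of Pursuers: `ψ` is a pair of headings that it prescribes in the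
state `x`. If only `P_i` is active, the heading of the other Pursuer is free. -/
def PursuersOptimal (β : Fin 2 → ℝ) (x : State) (ψ : Fin 2 → ℝ) : Prop :=
  (∀ i, SinglePursuerCase β x i → (ψ i : Real.Angle) = (los x i : Real.Angle)) ∧
  (JointCase β x → ∃ I ∈ aimPoints β x,
    ∀ i, (ψ i : Real.Angle) = (Complex.arg (I - x.P i) : Real.Angle))

/-- The headings `(φ*, ψ₁*, ψ₂*)` of all three players in the state `x`; in the joint case the
three players aim at the same point. -/
def OptimalHeadings (β : Fin 2 → ℝ) (x : State) (φ : ℝ) (ψ : Fin 2 → ℝ) : Prop :=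
  (∀ i, SinglePursuerCase β x i →
    (φ : Real.Angle) = (los x i : Real.Angle) ∧ (ψ i : Real.Angle) = (los x i : Real.Angle)) ∧
  (JointCase β x → ∃ I ∈ aimPoints β x,
    (φ : Real.Angle) = (Complex.arg (I - x.E) : Real.Angle) ∧
    ∀ i, (ψ i : Real.Angle) = (Complex.arg (I - x.P i) : Real.Angle))

/-- Almost everywhere on `[0, T]`, as long as the Evader has not been captured, the Evader uses its
state feedback. -/
def EvaderFollows (β : Fin 2 → ℝ) (T : ℝ) (x : ℝ → State) (φ : ℝ → ℝ) : Prop :=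
  ∀ᵐ t : ℝ, t ∈ Icc 0 T → (∀ s ∈ Icc 0 t, ¬ Captured (x s)) → EvaderOptimal β (x t) (φ t)

/-- Almost everywhere on `[0, T]`, as long as the Evader has not been captured, the Pursuers use
their state feedback. -/
def PursuersFollow (β : Fin 2 → ℝ) (T : ℝ) (x : ℝ → State) (ψ : Fin 2 → ℝ → ℝ) : Prop :=
  ∀ᵐ t : ℝ, t ∈ Icc 0 T → (∀ s ∈ Icc 0 t, ¬ Captured (x s)) →
    PursuersOptimal β (x t) (fun i => ψ i t)

/-- The feedback strategies are a saddle point with capture time `V` from the initial state `x₀`.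
`pursuers`: whatever the Evader does, against the feedback of the Pursuers it is captured at time
`V` at the latest. `evader`: whatever the Pursuers do, against the feedback of the Evader they do
not capture it before time `V`. -/
structure IsSaddlePoint (β : Fin 2 → ℝ) (x₀ : State) (V : ℝ) : Prop where
  pursuers : ∀ (T : ℝ) (x : ℝ → State) (φ : ℝ → ℝ) (ψ : Fin 2 → ℝ → ℝ),
    IsPlay β x₀ T x φ ψ → PursuersFollow β T x ψ → V ≤ T → ∃ t ∈ Icc 0 V, Captured (x t)
  evader : ∀ (T : ℝ) (x : ℝ → State) (φ : ℝ → ℝ) (ψ : Fin 2 → ℝ → ℝ),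
    IsPlay β x₀ T x φ ψ → EvaderFollows β T x φ → ∀ t ∈ Icc 0 T, Captured (x t) → V ≤ t

end TwoCutters

end

/-!
All geometry depends on the vectors `d i` from the Pursuers to the Evader only. For a direction
`u` of the Evader, `interceptTime (β i) u (d i)` is the time at which the `i`-th Pursuer can
intercept it, and `tf` is this time for `u = heading φ`. The value of the game is `max_u min_i` of
these times (`value`); the unit vectors where it is attained (`IsBest`) are the line-of-sight
directions in the single-pursuer cases and the directions of the aim points in the joint case.

First-order optimality of a best direction `w` gives Lagrange multipliers
(`IsBest.exists_isMultiplier`): weights `μ`, supported on the Pursuers that can intercept in the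
time of the value, for which the weighted mean of the centers of the Apollonius circles is `m • w`
with `m ≥ 0`. This is an exact dual description of the value: a direction `u` that survives until
`V` satisfies the quadratic inequalities `V² ≤ 2 V k_i ⟪u, d i⟫ + k_i ‖d i‖²`, where
`k_i = gain (β i)`, hence their `μ`-combination, which is an equality for `u = w`. It implies that
the best direction is unique, except that a collinear state can have two, which are mirror images
of each other (`IsMultiplier.eq_or_eq_reflect`). Both multipliers are positive in the joint
case, and hence the aim points are exactly the points at distance `V` in the best directions, and
the aim point is not on the line of centers, so that the circles have a second intersection point.

Along a play the value is a Lipschitz function of time, hence it is the integral of its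
derivative, and the saddle point follows from two one-sided bounds on this derivative that hold
almost everywhere before capture. If the Evader moves in a best direction, the rate is at least
`-1`, because the intercept times in a fixed direction decrease at most at the rate `1`
(`neg_one_le_of_hasDerivAt_value`). If the Pursuers use their feedback for a best direction `w`,
the rate is at most `-1`: the multipliers at the present time bound the value at later times from
above, and the bound is differentiated along later best directions that converge to `w`
(`le_neg_one_of_hasDerivAt_value`). Such directions exist by compactness and uniqueness. In a
collinear state the limit may be the mirror image of `w`; but almost every collinear time is a
limit from the right of collinear times, where the best directions may be reflected
(`exists_seq_isBest_tendsto`). So it does no harm if the Evader and the Pursuers disagree about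
which of two aim points to choose.

Under constant optimal headings the state contracts homothetically to the aim point in the joint
case. In a single-pursuer case the active Pursuer stays active, because the other one cannot reach
the point of capture any earlier.
-/

namespace TwoCutters
open Filter Topology

/-! ### Interception times -/

/-- The constant `1 / (b² - 1)` of a Pursuer of speed `b`. -/
noncomputable def gain (b : ℝ) : ℝ := 1 / (b ^ 2 - 1)

/-- The time in which a Pursuer of speed `b` intercepts an Evader of speed `1` that holds the
direction `u`, when `d` is the vector from the Pursuer to the Evader. -/
noncomputable def interceptTime (b : ℝ) (u d : ℂ) : ℝ :=
  gain b * inner ℝ u d + √(gain b ^ 2 * inner ℝ u d ^ 2 + gain b * ‖d‖ ^ 2)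

lemma gain_pos {b : ℝ} (hb : 1 < b) : 0 < gain b := by
  unfold gain
  have : 0 < b ^ 2 - 1 := by nlinarith
  positivity

lemma gain_mul {b : ℝ} (hb : 1 < b) : gain b * b ^ 2 = gain b + 1 := by
  unfold gain
  have : b ^ 2 - 1 ≠ 0 := by nlinarith
  field_simp
  ring

lemma interceptTime_nonneg {b : ℝ} (hb : 1 < b) (u d : ℂ) : 0 ≤ interceptTime b u d := by
  unfold interceptTime
  have hg := gain_pos hb
  have h1 : |gain b * inner ℝ u d| ≤ √(gain b ^ 2 * inner ℝ u d ^ 2 + gain b * ‖d‖ ^ 2) := by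
    apply Real.abs_le_sqrt
    nlinarith [mul_nonneg hg.le (sq_nonneg ‖d‖)]
  linarith [neg_abs_le (gain b * inner ℝ u d)]

/-- The interception time is a root of a quadratic polynomial. -/
lemma interceptTime_sq {b : ℝ} (hb : 1 < b) (u d : ℂ) :
    interceptTime b u d ^ 2 =
      2 * interceptTime b u d * (gain b * inner ℝ u d) + gain b * ‖d‖ ^ 2 := by
  have hg := gain_pos hb
  have h := Real.sq_sqrt (show 0 ≤ gain b ^ 2 * inner ℝ u d ^ 2 + gain b * ‖d‖ ^ 2 by positivity)
  unfold interceptTime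
  nlinarith

lemma interceptTime_pos {b : ℝ} (hb : 1 < b) (u : ℂ) {d : ℂ} (hd : d ≠ 0) :
    0 < interceptTime b u d := by
  refine (interceptTime_nonneg hb u d).lt_of_ne fun h => ?_
  have h2 := interceptTime_sq hb u d
  rw [← h] at h2
  have : 0 < gain b * ‖d‖ ^ 2 := by have := gain_pos hb; positivity
  linarith

lemma interceptTime_zero (b : ℝ) (u : ℂ) : interceptTime b u 0 = 0 := by
  simp [interceptTime]

lemma le_interceptTime_iff_sq_le {b : ℝ} (hb : 1 < b) (u d : ℂ) {τ : ℝ} (hτ : 0 ≤ τ) :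
    τ ≤ interceptTime b u d ↔ τ ^ 2 ≤ 2 * τ * (gain b * inner ℝ u d) + gain b * ‖d‖ ^ 2 := by
  have hg := gain_pos hb
  have h1 : |gain b * inner ℝ u d| ≤ √(gain b ^ 2 * inner ℝ u d ^ 2 + gain b * ‖d‖ ^ 2) := by
    apply Real.abs_le_sqrt
    nlinarith [mul_nonneg hg.le (sq_nonneg ‖d‖)]
  have h2 := Real.sqrt_nonneg (gain b ^ 2 * inner ℝ u d ^ 2 + gain b * ‖d‖ ^ 2)
  have h3 : τ ≤ interceptTime b u d ↔
      |τ - gain b * inner ℝ u d| ≤ √(gain b ^ 2 * inner ℝ u d ^ 2 + gain b * ‖d‖ ^ 2) := by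
    unfold interceptTime
    rw [abs_le] at h1 ⊢
    constructor
    · intro h
      constructor <;> linarith
    · intro h
      linarith [h.2]
  rw [h3, ← Real.sqrt_sq_eq_abs, Real.sqrt_le_sqrt_iff (by positivity)]
  constructor <;> intro h <;> nlinarith

lemma lt_interceptTime_iff_sq_lt {b : ℝ} (hb : 1 < b) (u d : ℂ) {τ : ℝ} (hτ : 0 < τ) :
    τ < interceptTime b u d ↔ τ ^ 2 < 2 * τ * (gain b * inner ℝ u d) + gain b * ‖d‖ ^ 2 := by
  have h1 := le_interceptTime_iff_sq_le hb u d hτ.le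
  have h2 := interceptTime_sq hb u d
  constructor
  · intro h
    refine (h1.1 h.le).lt_of_ne fun he => ?_
    set T := interceptTime b u d
    set p := gain b * inner ℝ u d
    have hs : 0 ≤ gain b * ‖d‖ ^ 2 := by have := gain_pos hb; positivity
    -- both `τ` and `T` are roots, so `τ T = -s` by Vieta's formula
    have hv : (T - τ) * (T + τ - 2 * p) = 0 := by nlinarith
    have hv' : T + τ = 2 * p := by
      rcases mul_eq_zero.1 hv with h' | h' <;> linarith
    have : τ * T = -(gain b * ‖d‖ ^ 2) := by nlinarith
    nlinarith [mul_pos hτ (hτ.trans h)]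
  · intro h
    refine (h1.2 h.le).lt_of_ne fun he => ?_
    rw [← he] at h2
    linarith

lemma gain_mul_norm_add_sq {b : ℝ} (hb : 1 < b) {u : ℂ} (hu : ‖u‖ = 1) (d : ℂ) (τ : ℝ) :
    gain b * (‖d + τ • u‖ ^ 2 - (b * τ) ^ 2) =
      2 * τ * (gain b * inner ℝ u d) + gain b * ‖d‖ ^ 2 - τ ^ 2 := by
  rw [norm_add_sq_real, inner_smul_right, norm_smul, hu, real_inner_comm d u]
  have := gain_mul hb
  have h2 : (‖τ‖ * 1) ^ 2 = τ ^ 2 := by simp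
  rw [h2]
  linear_combination (-τ ^ 2) * this

/-- The Evader that holds the direction `u` is not overtaken before time `τ` if and only if the
Pursuer cannot reach the point that the Evader reaches at time `τ` any earlier. -/
lemma le_interceptTime_iff {b : ℝ} (hb : 1 < b) {u : ℂ} (hu : ‖u‖ = 1) (d : ℂ) {τ : ℝ}
    (hτ : 0 ≤ τ) : τ ≤ interceptTime b u d ↔ b * τ ≤ ‖d + τ • u‖ := by
  rw [le_interceptTime_iff_sq_le hb u d hτ, ← sub_nonneg, ← gain_mul_norm_add_sq hb hu,
    mul_nonneg_iff_of_pos_left (gain_pos hb), sub_nonneg]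
  exact sq_le_sq₀ (by positivity) (norm_nonneg _)

lemma norm_add_interceptTime {b : ℝ} (hb : 1 < b) {u : ℂ} (hu : ‖u‖ = 1) (d : ℂ) :
    ‖d + interceptTime b u d • u‖ = b * interceptTime b u d := by
  have h := gain_mul_norm_add_sq hb hu d (interceptTime b u d)
  rw [← interceptTime_sq hb, sub_self] at h
  rcases mul_eq_zero.1 h with h | h
  · exact absurd h (gain_pos hb).ne'
  · exact (sq_eq_sq₀ (norm_nonneg _)
      (mul_nonneg (by linarith) (interceptTime_nonneg hb u d))).1 (by linarith)

lemma interceptTime_eq_of_norm {b : ℝ} (hb : 1 < b) {u : ℂ} (hu : ‖u‖ = 1) (d : ℂ) {τ : ℝ}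
    (hτ : 0 < τ) (h : ‖d + τ • u‖ = b * τ) : interceptTime b u d = τ := by
  refine le_antisymm (not_lt.1 fun hlt => ?_) ((le_interceptTime_iff hb hu d hτ.le).2 h.ge)
  have h1 := gain_mul_norm_add_sq hb hu d τ
  rw [h, sub_self, mul_zero] at h1
  linarith [(lt_interceptTime_iff_sq_lt hb u d hτ).1 hlt]

lemma interceptTime_le {b : ℝ} (hb : 1 < b) {u : ℂ} (hu : ‖u‖ = 1) (d : ℂ) :
    interceptTime b u d ≤ ‖d‖ / (b - 1) := by
  have h := norm_add_interceptTime hb hu d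
  have h2 := norm_add_le d (interceptTime b u d • u)
  rw [norm_smul, hu, Real.norm_of_nonneg (interceptTime_nonneg hb u d)] at h2
  rw [le_div_iff₀ (by linarith)]
  linarith

lemma interceptTime_smul_self {b : ℝ} (hb : 1 < b) {e : ℂ} (he : ‖e‖ = 1) {s : ℝ} (hs : 0 < s) :
    interceptTime b e (s • e) = s / (b - 1) := by
  have hb' : 0 < b - 1 := by linarith
  apply interceptTime_eq_of_norm hb he _ (by positivity)
  rw [← add_smul, norm_smul, he, Real.norm_of_nonneg (by positivity)]
  field_simp
  ring

/-- The interception time is longest in the direction of the line of sight. -/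
lemma interceptTime_le_smul_self {b : ℝ} (hb : 1 < b) {e u : ℂ} (he : ‖e‖ = 1) (hu : ‖u‖ = 1)
    {s : ℝ} (hs : 0 < s) : interceptTime b u (s • e) ≤ interceptTime b e (s • e) := by
  rw [interceptTime_smul_self hb he hs]
  refine (interceptTime_le hb hu _).trans_eq ?_
  rw [norm_smul, he, Real.norm_of_nonneg hs.le, mul_one]

lemma interceptTime_homogeneous {b : ℝ} (u d : ℂ) {s : ℝ} (hs : 0 ≤ s) :
    interceptTime b u (s • d) = s * interceptTime b u d := by
  unfold interceptTime
  rw [inner_smul_right, norm_smul, Real.norm_of_nonneg hs,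
    show gain b ^ 2 * (s * inner ℝ u d) ^ 2 + gain b * (s * ‖d‖) ^ 2 =
      s ^ 2 * (gain b ^ 2 * inner ℝ u d ^ 2 + gain b * ‖d‖ ^ 2) by ring,
    Real.sqrt_mul (sq_nonneg s), Real.sqrt_sq hs]
  ring

lemma continuous_interceptTime (b : ℝ) :
    Continuous fun p : ℂ × ℂ => interceptTime b p.1 p.2 := by
  unfold interceptTime
  fun_prop

/-- The square root in the interception time is the Euclidean norm of the pair
`(k ⟪u, d⟫, √k ‖d‖)`, hence Lipschitz in `d`. -/
lemma interceptTime_sub_le {b : ℝ} (hb : 1 < b) {u : ℂ} (hu : ‖u‖ = 1) (d d' : ℂ) :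
    interceptTime b u d - interceptTime b u d' ≤ (2 * gain b + √(gain b)) * ‖d - d'‖ := by
  have hg := gain_pos hb
  set z : ℂ → ℂ := fun d => ⟨gain b * inner ℝ u d, √(gain b) * ‖d‖⟩ with hz
  have hn : ∀ d, √(gain b ^ 2 * inner ℝ u d ^ 2 + gain b * ‖d‖ ^ 2) = ‖z d‖ := by
    intro d
    rw [Complex.norm_def (z d), Complex.normSq_apply]
    congr 1
    simp only [hz]
    nlinarith [Real.mul_self_sqrt hg.le]
  have h1 : ‖z d‖ - ‖z d'‖ ≤ ‖z d - z d'‖ := norm_sub_norm_le _ _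
  have h2 : ‖z d - z d'‖ ≤ |(z d - z d').re| + |(z d - z d').im| :=
    Complex.norm_le_abs_re_add_abs_im _
  have h3 : |gain b * inner ℝ u d - gain b * inner ℝ u d'| ≤ gain b * ‖d - d'‖ := by
    rw [← mul_sub, ← inner_sub_right, abs_mul, abs_of_pos hg]
    gcongr
    simpa [hu] using abs_real_inner_le_norm u (d - d')
  have h4 : |√(gain b) * ‖d‖ - √(gain b) * ‖d'‖| ≤ √(gain b) * ‖d - d'‖ := by
    rw [← mul_sub, abs_mul, abs_of_nonneg (Real.sqrt_nonneg _)]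
    gcongr
    exact abs_norm_sub_norm_le _ _
  have h5 : |(z d - z d').re| = |gain b * inner ℝ u d - gain b * inner ℝ u d'| := rfl
  have h6 : |(z d - z d').im| = |√(gain b) * ‖d‖ - √(gain b) * ‖d'‖| := rfl
  unfold interceptTime
  rw [hn, hn]
  linarith [le_abs_self (gain b * inner ℝ u d - gain b * inner ℝ u d')]

/-- While the Evader holds the direction `u`, its interception time decreases at most at the rate
of the time that has passed, whatever the Pursuer does. -/
lemma interceptTime_sub_le_of_step {b : ℝ} (hb : 1 < b) {u v : ℂ} (hu : ‖u‖ = 1) (hv : ‖v‖ = 1)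
    (d : ℂ) {h : ℝ} (hh : 0 ≤ h) :
    interceptTime b u d - h ≤ interceptTime b u (d + h • (u - b • v)) := by
  rcases le_total (interceptTime b u d - h) 0 with h0 | h0
  · exact h0.trans (interceptTime_nonneg hb _ _)
  rw [le_interceptTime_iff hb hu _ h0, mul_sub, ← norm_add_interceptTime hb hu]
  set T := interceptTime b u d
  have : d + h • (u - b • v) + (T - h) • u = d + T • u - (b * h) • v := by
    module
  rw [this]
  have h1 := norm_sub_norm_le (d + T • u) ((b * h) • v)
  rwa [norm_smul, hv, Real.norm_of_nonneg (mul_nonneg (by linarith) hh), mul_one] at h1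

/-! ### Best directions of the Evader -/

section Directions

/-- The time for which the Evader survives if it holds the direction `u`, where `d i` is the vector
from the `i`-th Pursuer to the Evader. -/
noncomputable def survival (β : Fin 2 → ℝ) (d : Fin 2 → ℂ) (u : ℂ) : ℝ :=
  min (interceptTime (β 0) u (d 0)) (interceptTime (β 1) u (d 1))

/-- `w` is a unit vector that maximizes the survival time. -/
def IsBest (β : Fin 2 → ℝ) (d : Fin 2 → ℂ) (w : ℂ) : Prop :=
  ‖w‖ = 1 ∧ ∀ u, ‖u‖ = 1 → survival β d u ≤ survival β d w

/-- The value of the game: the longest survival time of an Evader that holds its direction. -/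
noncomputable def value (β : Fin 2 → ℝ) (d : Fin 2 → ℂ) : ℝ :=
  sSup (survival β d '' Metric.sphere 0 1)

/-- Lagrange multipliers for the problem to maximize the survival time: a convex combination of the
centers `gain (β i) • d i` of the Apollonius circles (relative to the Evader) that is a nonnegative
multiple of `w`, and that charges only Pursuers whose interception time is the value. -/
structure IsMultiplier (β : Fin 2 → ℝ) (d : Fin 2 → ℂ) (w : ℂ) (μ : Fin 2 → ℝ) (m : ℝ) :
    Prop where
  nonneg : ∀ i, 0 ≤ μ i
  sum_eq : μ 0 + μ 1 = 1
  scale_nonneg : 0 ≤ m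
  center : (μ 0 * gain (β 0)) • d 0 + (μ 1 * gain (β 1)) • d 1 = m • w
  active : ∀ i, μ i ≠ 0 → interceptTime (β i) w (d i) = value β d

variable {β : Fin 2 → ℝ} {d : Fin 2 → ℂ} {u w : ℂ}

lemma survival_le (β : Fin 2 → ℝ) (d : Fin 2 → ℂ) (u : ℂ) (i : Fin 2) :
    survival β d u ≤ interceptTime (β i) u (d i) := by
  fin_cases i
  · exact min_le_left _ _
  · exact min_le_right _ _

lemma le_survival {τ : ℝ} (h : ∀ i, τ ≤ interceptTime (β i) u (d i)) : τ ≤ survival β d u :=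
  le_min (h 0) (h 1)

lemma continuous_survival (β : Fin 2 → ℝ) :
    Continuous fun p : (Fin 2 → ℂ) × ℂ => survival β p.1 p.2 := by
  unfold survival
  have h : ∀ i, Continuous fun p : (Fin 2 → ℂ) × ℂ => interceptTime (β i) p.2 (p.1 i) := fun i =>
    (continuous_interceptTime (β i)).comp (by fun_prop : Continuous fun p : (Fin 2 → ℂ) × ℂ =>
      (p.2, p.1 i))
  exact (h 0).min (h 1)

lemma exists_isBest (β : Fin 2 → ℝ) (d : Fin 2 → ℂ) : ∃ w, IsBest β d w := by
  have hc : Continuous (survival β d) :=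
    (continuous_survival β).comp (by fun_prop : Continuous fun u : ℂ => (d, u))
  obtain ⟨w, hw, h⟩ := (isCompact_sphere (0 : ℂ) 1).exists_isMaxOn
    ⟨1, by simp⟩ hc.continuousOn
  exact ⟨w, by simpa using hw, fun u hu => h (by simpa using hu)⟩

lemma IsBest.value_eq (hw : IsBest β d w) : value β d = survival β d w := by
  refine IsGreatest.csSup_eq ⟨⟨w, by simpa using hw.1, rfl⟩, ?_⟩
  rintro _ ⟨u, hu, rfl⟩
  exact hw.2 u (by simpa using hu)

lemma survival_le_value (hu : ‖u‖ = 1) : survival β d u ≤ value β d := by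
  obtain ⟨w, hw⟩ := exists_isBest β d
  rw [hw.value_eq]
  exact hw.2 u hu

lemma isBest_iff : IsBest β d w ↔ ‖w‖ = 1 ∧ survival β d w = value β d := by
  constructor
  · intro h
    exact ⟨h.1, h.value_eq.symm⟩
  · rintro ⟨h1, h2⟩
    exact ⟨h1, fun u hu => h2 ▸ survival_le_value hu⟩

lemma IsBest.value_le (hw : IsBest β d w) (i : Fin 2) :
    value β d ≤ interceptTime (β i) w (d i) := hw.value_eq.trans_le (survival_le β d w i)

lemma value_nonneg (hβ : ∀ i, 1 < β i) (d : Fin 2 → ℂ) : 0 ≤ value β d := by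
  obtain ⟨w, hw⟩ := exists_isBest β d
  rw [hw.value_eq]
  exact le_survival fun i => interceptTime_nonneg (hβ i) _ _

lemma value_pos (hβ : ∀ i, 1 < β i) (hd : ∀ i, d i ≠ 0) : 0 < value β d := by
  obtain ⟨w, hw⟩ := exists_isBest β d
  rw [hw.value_eq]
  exact lt_min (interceptTime_pos (hβ 0) _ (hd 0)) (interceptTime_pos (hβ 1) _ (hd 1))

lemma value_eq_zero {i : Fin 2} (hβ : ∀ i, 1 < β i) (hd : d i = 0) : value β d = 0 := by
  refine le_antisymm ?_ (value_nonneg hβ d)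
  obtain ⟨w, hw⟩ := exists_isBest β d
  refine (hw.value_le i).trans_eq ?_
  rw [hd, interceptTime_zero]

lemma exists_lipschitzWith_value (hβ : ∀ i, 1 < β i) : ∃ L : NNReal, LipschitzWith L (value β) := by
  set K : Fin 2 → ℝ := fun i => 2 * gain (β i) + √(gain (β i)) with hK
  have hK0 : ∀ i, 0 ≤ K i := fun i => by have := gain_pos (hβ i); positivity
  refine ⟨(K 0 + K 1).toNNReal, LipschitzWith.of_le_add_mul _ fun d d' => ?_⟩
  obtain ⟨w, hw⟩ := exists_isBest β d
  have h : value β d - (K 0 + K 1) * dist d d' ≤ survival β d' w := by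
    refine le_survival fun i => ?_
    have h1 := interceptTime_sub_le (hβ i) hw.1 (d i) (d' i)
    have h2 : ‖d i - d' i‖ ≤ dist d d' := by
      rw [← dist_eq_norm]
      exact dist_le_pi_dist d d' i
    have h3 : K i * ‖d i - d' i‖ ≤ (K 0 + K 1) * dist d d' := by
      have : K i ≤ K 0 + K 1 := by
        fin_cases i
        · simpa using hK0 1
        · simpa using hK0 0
      exact mul_le_mul this h2 (norm_nonneg _) (add_nonneg (hK0 0) (hK0 1))
    linarith [hw.value_le i]
  have := survival_le_value (β := β) (d := d') hw.1
  rw [Real.coe_toNNReal _ (add_nonneg (hK0 0) (hK0 1))]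
  linarith

/-- First-order optimality of the direction `θ = 0` for the minimum of two functions
`2 V (a cos θ + b sin θ) - 2 V a + e` on the circle, where `e` is the slack at `θ = 0`. In the
coordinate `τ = tan (θ / 2)` such a function is the quotient of
`4 V (τ b - τ² a) + e (1 + τ²)` by `1 + τ²`. -/
lemma exists_multiplier_of_forall_not_lt {V a₀ b₀ e₀ a₁ b₁ e₁ : ℝ} (hV : 0 < V)
    (he₀ : 0 ≤ e₀) (he₁ : 0 ≤ e₁) (hmin : e₀ = 0 ∨ e₁ = 0)
    (H : ∀ τ : ℝ, 0 < 4 * V * (τ * b₀ - τ ^ 2 * a₀) + e₀ * (1 + τ ^ 2) →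
      ¬ 0 < 4 * V * (τ * b₁ - τ ^ 2 * a₁) + e₁ * (1 + τ ^ 2)) :
    ∃ μ₀ μ₁ : ℝ, 0 ≤ μ₀ ∧ 0 ≤ μ₁ ∧ μ₀ + μ₁ = 1 ∧ μ₀ * b₀ + μ₁ * b₁ = 0 ∧
      0 ≤ μ₀ * a₀ + μ₁ * a₁ ∧ (μ₀ ≠ 0 → e₀ = 0) ∧ (μ₁ ≠ 0 → e₁ = 0) := by
  -- if one function improves in all nonzero directions close to `0`, then the other one never does
  have key : ∀ {a b a' b' e : ℝ}, (∀ᶠ τ in 𝓝[≠] (0 : ℝ), 0 < 4 * V * (τ * b - τ ^ 2 * a) +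
      e * (1 + τ ^ 2)) → (∀ τ : ℝ, 0 < 4 * V * (τ * b - τ ^ 2 * a) + e * (1 + τ ^ 2) →
      ¬ 0 < 4 * V * (τ * b' - τ ^ 2 * a')) → b' = 0 ∧ 0 ≤ a' := by
    intro a b a' b' e h1 h2
    have h3 : ∀ᶠ τ in 𝓝[≠] (0 : ℝ), τ * b' - τ ^ 2 * a' ≤ 0 := by
      filter_upwards [h1] with τ hτ
      have := h2 τ hτ
      by_contra! hc
      exact this (by positivity)
    have hp : ∀ᶠ τ in 𝓝[>] (0 : ℝ), τ * b' - τ ^ 2 * a' ≤ 0 :=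
      h3.filter_mono (nhdsWithin_mono _ fun x hx => ne_of_gt hx)
    have hm : ∀ᶠ τ in 𝓝[<] (0 : ℝ), τ * b' - τ ^ 2 * a' ≤ 0 :=
      h3.filter_mono (nhdsWithin_mono _ fun x hx => ne_of_lt hx)
    have hb : b' = 0 := by
      refine le_antisymm ?_ ?_
      · have ht : Tendsto (fun τ : ℝ => b' - τ * a') (𝓝[>] 0) (𝓝 (b' - 0 * a')) :=
          (Continuous.tendsto (by fun_prop) 0).mono_left nhdsWithin_le_nhds
        rw [zero_mul, sub_zero] at ht
        refine le_of_tendsto ht ?_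
        filter_upwards [hp, self_mem_nhdsWithin] with τ h hτ
        rw [mem_Ioi] at hτ
        by_contra! hc
        nlinarith [mul_pos hτ hc]
      · have ht : Tendsto (fun τ : ℝ => b' - τ * a') (𝓝[<] 0) (𝓝 (b' - 0 * a')) :=
          (Continuous.tendsto (by fun_prop) 0).mono_left nhdsWithin_le_nhds
        rw [zero_mul, sub_zero] at ht
        refine ge_of_tendsto ht ?_
        filter_upwards [hm, self_mem_nhdsWithin] with τ h hτ
        rw [mem_Iio] at hτ
        by_contra! hc
        nlinarith [mul_pos_of_neg_of_neg hτ hc]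
    refine ⟨hb, ?_⟩
    obtain ⟨τ, h, hτ⟩ := (hp.and self_mem_nhdsWithin).exists
    rw [hb] at h
    by_contra! hc
    nlinarith [mul_pos_of_neg_of_neg hc (neg_lt_zero.2 (pow_pos hτ 2))]
  have slack : ∀ {a b e : ℝ}, 0 < e → ∀ᶠ τ in 𝓝[≠] (0 : ℝ),
      0 < 4 * V * (τ * b - τ ^ 2 * a) + e * (1 + τ ^ 2) := by
    intro a b e he
    have ht : Tendsto (fun τ : ℝ => 4 * V * (τ * b - τ ^ 2 * a) + e * (1 + τ ^ 2)) (𝓝[≠] 0)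
        (𝓝 (4 * V * (0 * b - 0 ^ 2 * a) + e * (1 + 0 ^ 2))) :=
      (Continuous.tendsto (by fun_prop) 0).mono_left nhdsWithin_le_nhds
    exact ht.eventually (lt_mem_nhds (by simpa using he))
  have flat : ∀ {a b : ℝ}, b = 0 → a < 0 → ∀ᶠ τ in 𝓝[≠] (0 : ℝ),
      0 < 4 * V * (τ * b - τ ^ 2 * a) + 0 * (1 + τ ^ 2) := by
    intro a b hb ha
    filter_upwards [self_mem_nhdsWithin] with τ hτ
    have h1 : 0 < τ ^ 2 := by have : τ ≠ 0 := hτ; positivity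
    have h2 : 0 < τ ^ 2 * -a := mul_pos h1 (by linarith)
    rw [hb]
    nlinarith [mul_pos hV h2]
  rcases he₀.eq_or_lt with h0 | h0
  swap
  · have h1 : e₁ = 0 := hmin.resolve_left h0.ne'
    subst h1
    obtain ⟨hb, ha⟩ := key (slack h0) (fun τ h => by simpa using H τ h)
    exact ⟨0, 1, by simp, by simp, by simp, by simp [hb], by simpa using ha, by simp, by simp⟩
  subst h0
  rcases he₁.eq_or_lt with h1 | h1
  swap
  · obtain ⟨hb, ha⟩ := key (slack h1) (fun τ h h' => H τ (by simpa using h') h)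
    exact ⟨1, 0, by simp, by simp, by simp, by simp [hb], by simpa using ha, by simp, by simp⟩
  subst h1
  by_cases hb0 : b₀ = 0
  · by_cases ha0 : 0 ≤ a₀
    · exact ⟨1, 0, by simp, by simp, by simp, by simp [hb0], by simpa using ha0, by simp, by simp⟩
    · obtain ⟨hb, ha⟩ := key (flat hb0 (not_le.1 ha0)) (fun τ h => by simpa using H τ h)
      exact ⟨0, 1, by simp, by simp, by simp, by simp [hb], by simpa using ha, by simp, by simp⟩
  by_cases hb1 : b₁ = 0
  · by_cases ha1 : 0 ≤ a₁
    · exact ⟨0, 1, by simp, by simp, by simp, by simp [hb1], by simpa using ha1, by simp, by simp⟩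
    · obtain ⟨hb, ha⟩ := key (flat hb1 (not_le.1 ha1)) (fun τ h h' => H τ (by simpa using h') h)
      exact absurd hb hb0
  have H' : ∀ τ : ℝ, 0 < τ * b₀ - τ ^ 2 * a₀ → ¬ 0 < τ * b₁ - τ ^ 2 * a₁ := by
    intro τ h h'
    exact H τ (by simpa using mul_pos (by positivity) h) (by simpa using mul_pos (by positivity) h')
  -- the tangential parts have opposite signs, or else a small rotation improves both functions
  have small : ∀ {a b c : ℝ}, 0 < b * c → ∀ᶠ ε in 𝓝[>] (0 : ℝ),
      0 < (ε * c) * b - (ε * c) ^ 2 * a := by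
    intro a b c hbc
    have ht : Tendsto (fun ε : ℝ => b * c - ε * c ^ 2 * a) (𝓝[>] 0)
        (𝓝 (b * c - 0 * c ^ 2 * a)) :=
      (Continuous.tendsto (by fun_prop) 0).mono_left nhdsWithin_le_nhds
    filter_upwards [ht.eventually (lt_mem_nhds (by simpa using hbc)),
      self_mem_nhdsWithin] with ε h hε
    rw [mem_Ioi] at hε
    nlinarith [mul_pos hε h]
  have hneg : b₀ * b₁ < 0 := by
    refine (mul_ne_zero hb0 hb1).lt_of_le (not_lt.1 fun hpos => ?_)
    obtain ⟨ε, h, h'⟩ := ((small (a := a₀) (mul_self_pos.2 hb0)).and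
      (small (a := a₁) (show 0 < b₁ * b₀ by linarith))).exists
    exact H' _ h h'
  -- the combination in which the tangential parts cancel has a nonnegative radial part, or else
  -- a suitable rotation, which need not be small, improves both functions
  have main : ∀ {a b a' b' : ℝ}, 0 < b → b' < 0 → (∀ τ : ℝ, 0 < τ * b - τ ^ 2 * a →
      ¬ 0 < τ * b' - τ ^ 2 * a') → b' * a ≤ b * a' := by
    intro a b a' b' hb hb' h
    by_contra! hc
    rcases lt_or_ge a' 0 with ha' | ha'
    · have h0 : 0 < b' / a' := div_pos_of_neg_of_neg hb' ha'
      have h1 : b' / a' * a < b := by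
        rw [div_mul_eq_mul_div, div_lt_iff_of_neg ha']
        linarith
      have ht : Tendsto (fun τ : ℝ => τ * a) (𝓝[>] (b' / a')) (𝓝 (b' / a' * a)) :=
        (Continuous.tendsto (by fun_prop) _).mono_left nhdsWithin_le_nhds
      obtain ⟨τ, hτ, hτ'⟩ := ((ht.eventually (gt_mem_nhds h1)).and self_mem_nhdsWithin).exists
      have hτ0 := h0.trans hτ'
      rw [div_lt_iff_of_neg ha'] at hτ'
      exact h τ (by nlinarith [mul_pos hτ0 (sub_pos.2 hτ)])
        (by nlinarith [mul_pos hτ0 (sub_pos.2 hτ')])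
    · have ha : a < 0 := by
        by_contra! ha
        nlinarith [mul_nonneg hb.le ha', mul_nonneg (neg_nonneg.2 hb'.le) ha]
      have h0 : b / a < 0 := div_neg_of_pos_of_neg hb ha
      have h1 : b' < b / a * a' := by
        rw [div_mul_eq_mul_div, lt_div_iff_of_neg ha]
        linarith
      have ht : Tendsto (fun τ : ℝ => τ * a') (𝓝[<] (b / a)) (𝓝 (b / a * a')) :=
        (Continuous.tendsto (by fun_prop) _).mono_left nhdsWithin_le_nhds
      obtain ⟨τ, hτ, hτ'⟩ := ((ht.eventually (lt_mem_nhds h1)).and self_mem_nhdsWithin).exists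
      have hτ0 := hτ'.trans h0
      rw [lt_div_iff_of_neg ha] at hτ'
      exact h τ (by nlinarith [mul_pos_of_neg_of_neg hτ0 (sub_neg.2 hτ')])
        (by nlinarith [mul_pos_of_neg_of_neg hτ0 (sub_neg.2 hτ)])
  rcases lt_or_gt_of_ne hb0 with hb | hb
  · have hb' : 0 < b₁ := by
      by_contra! hc
      nlinarith [mul_nonneg_of_nonpos_of_nonpos hb.le hc]
    have hm := main hb' hb fun τ h h' => H' τ h' h
    have hs : 0 < b₁ - b₀ := by linarith
    refine ⟨b₁ / (b₁ - b₀), -b₀ / (b₁ - b₀), by positivity, div_nonneg (by linarith) hs.le,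
      by field_simp; ring, by field_simp; ring, ?_, by simp, by simp⟩
    rw [show b₁ / (b₁ - b₀) * a₀ + -b₀ / (b₁ - b₀) * a₁ = (b₁ * a₀ - b₀ * a₁) / (b₁ - b₀) by ring]
    exact div_nonneg (by linarith) hs.le
  · have hb' : b₁ < 0 := by
      by_contra! hc
      nlinarith [mul_nonneg hb.le hc]
    have hm := main hb hb' H'
    have hs : 0 < b₀ - b₁ := by linarith
    refine ⟨-b₁ / (b₀ - b₁), b₀ / (b₀ - b₁), div_nonneg (by linarith) hs.le, by positivity,
      by field_simp; ring, by field_simp; ring, ?_, by simp, by simp⟩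
    rw [show -b₁ / (b₀ - b₁) * a₀ + b₀ / (b₀ - b₁) * a₁ = (b₀ * a₁ - b₁ * a₀) / (b₀ - b₁) by ring]
    exact div_nonneg (by linarith) hs.le

/-! ### Multipliers and uniqueness of the best direction -/

open ComplexConjugate in
/-- Reflection of `w` in the line that is spanned by `d`. -/
noncomputable def reflect (d w : ℂ) : ℂ := d / conj d * conj w

open ComplexConjugate in
/-- The vectors from the two Pursuers to the Evader are parallel. -/
def Parallel (d : Fin 2 → ℂ) : Prop := (conj (d 0) * d 1).im = 0

lemma inner_eq (u z : ℂ) : inner ℝ u z = u.re * z.re + u.im * z.im := by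
  rw [Complex.inner]
  simp
  ring

lemma norm_eq_one_iff (u : ℂ) : ‖u‖ = 1 ↔ u.re ^ 2 + u.im ^ 2 = 1 := by
  rw [Complex.norm_def, Real.sqrt_eq_one, Complex.normSq_apply, sq, sq]

lemma inner_mul_self {w : ℂ} (hw : ‖w‖ = 1) : inner ℝ w w = 1 := by
  rw [real_inner_self_eq_norm_sq, hw, one_pow]

lemma eq_of_one_le_inner (hu : ‖u‖ = 1) (hw : ‖w‖ = 1) (h : 1 ≤ inner ℝ u w) : u = w := by
  rw [← sub_eq_zero, ← norm_eq_zero, ← sq_eq_zero_iff]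
  refine le_antisymm ?_ (sq_nonneg _)
  rw [norm_sub_sq_real, hu, hw]
  linarith

lemma norm_reflect {d : ℂ} (hd : d ≠ 0) (w : ℂ) : ‖reflect d w‖ = ‖w‖ := by
  simp [reflect, hd]

lemma reflect_reflect {d : ℂ} (hd : d ≠ 0) (w : ℂ) : reflect d (reflect d w) = w := by
  have : (starRingEnd ℂ) d ≠ 0 := by simpa using hd
  simp only [reflect, map_mul, map_div₀, Complex.conj_conj]
  field_simp

lemma inner_reflect {d e : ℂ} (hd : d ≠ 0) (h : ((starRingEnd ℂ) d * e).im = 0) (w : ℂ) :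
    inner ℝ (reflect d w) e = inner ℝ w e := by
  have hd' : (starRingEnd ℂ) d ≠ 0 := by simpa using hd
  obtain ⟨t, ht⟩ : ∃ t : ℝ, (starRingEnd ℂ) d * e = t := ⟨_, (Complex.ext rfl (by simpa using h))⟩
  have he : e = t / (starRingEnd ℂ) d := by field_simp; rw [← ht, mul_comm]
  rw [real_inner_comm, real_inner_comm e w, he, Complex.inner, Complex.inner]
  rw [← Complex.conj_re]
  congr 1
  simp only [reflect, map_mul, map_div₀, Complex.conj_conj, Complex.conj_ofReal]
  field_simp

lemma eq_or_eq_reflect {d : ℂ} (hd : d ≠ 0) (hn : ‖u‖ = ‖w‖) (h : inner ℝ u d = inner ℝ w d) :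
    u = w ∨ u = reflect d w := by
  have hd' : (starRingEnd ℂ) d ≠ 0 := by simpa using hd
  set z := u * (starRingEnd ℂ) d with hz
  set z' := w * (starRingEnd ℂ) d with hz'
  have hre : z.re = z'.re := by
    rw [inner_eq, inner_eq] at h
    simp [hz, hz']
    linarith
  have hns : Complex.normSq z = Complex.normSq z' := by
    simp [hz, hz', Complex.normSq_eq_norm_sq, hn]
  have him : z.im = z'.im ∨ z.im = -z'.im := by
    rw [Complex.normSq_apply, Complex.normSq_apply, hre] at hns
    exact sq_eq_sq_iff_eq_or_eq_neg.1 (by linarith)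
  rcases him with him | him
  · exact Or.inl (mul_right_cancel₀ hd' (Complex.ext hre him))
  · right
    have : z = (starRingEnd ℂ) z' := Complex.ext (by simpa using hre) (by simpa using him)
    rw [hz, hz', map_mul, Complex.conj_conj] at this
    rw [reflect, div_mul_eq_mul_div, eq_div_iff hd', this, mul_comm]

lemma isBest_reflect (hd : d 0 ≠ 0) (h : Parallel d) (hw : IsBest β d w) :
    IsBest β d (reflect (d 0) w) := by
  have h0 : inner ℝ (reflect (d 0) w) (d 0) = inner ℝ w (d 0) :=
    inner_reflect hd (by rw [mul_comm, Complex.mul_conj]; simp) w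
  have h1 : inner ℝ (reflect (d 0) w) (d 1) = inner ℝ w (d 1) := inner_reflect hd h w
  rw [isBest_iff] at hw ⊢
  refine ⟨by rw [norm_reflect hd, hw.1], ?_⟩
  rw [← hw.2]
  simp only [survival, interceptTime, h0, h1]

lemma IsBest.sq_le (hβ : ∀ i, 1 < β i) (hw : IsBest β d w) (i : Fin 2) :
    value β d ^ 2 ≤ 2 * value β d * (gain (β i) * inner ℝ w (d i)) + gain (β i) * ‖d i‖ ^ 2 :=
  (le_interceptTime_iff_sq_le (hβ i) _ _ (value_nonneg hβ d)).1 (hw.value_le i)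

/-- Every best direction has Lagrange multipliers. -/
lemma IsBest.exists_isMultiplier (hβ : ∀ i, 1 < β i) (hd : ∀ i, d i ≠ 0) (hw : IsBest β d w) :
    ∃ μ m, IsMultiplier β d w μ m := by
  set V := value β d with hVdef
  have hV : 0 < V := value_pos hβ hd
  set a : Fin 2 → ℝ := fun i => gain (β i) * inner ℝ w (d i) with ha
  set b : Fin 2 → ℝ := fun i => gain (β i) * inner ℝ (Complex.I * w) (d i) with hb
  set e : Fin 2 → ℝ := fun i => 2 * V * a i + gain (β i) * ‖d i‖ ^ 2 - V ^ 2 with he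
  have he0 : ∀ i, 0 ≤ e i := fun i => sub_nonneg.2 (hw.sq_le hβ i)
  have act : ∀ i, e i = 0 → interceptTime (β i) w (d i) = V := by
    intro i hi
    refine le_antisymm (not_lt.1 fun hlt => ?_) (hw.value_le i)
    have := (lt_interceptTime_iff_sq_lt (hβ i) _ _ hV).1 hlt
    simp only [he, ha] at hi
    linarith
  have hmin : e 0 = 0 ∨ e 1 = 0 := by
    by_contra! hc
    have h : ∀ i, e i ≠ 0 → V < interceptTime (β i) w (d i) := by
      intro i hi
      rw [lt_interceptTime_iff_sq_lt (hβ i) _ _ hV]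
      have := (he0 i).lt_of_ne' hi
      simp only [he, ha] at this
      linarith
    have := hw.value_eq
    exact absurd (lt_min (h 0 hc.1) (h 1 hc.2)) (by rw [survival] at this; exact this.ge.not_gt)
  -- the rotation of `w` by the angle `2 arctan τ`
  have rot : ∀ τ : ℝ, ∃ u : ℂ, ‖u‖ = 1 ∧ ∀ i,
      0 < 4 * V * (τ * b i - τ ^ 2 * a i) + e i * (1 + τ ^ 2) →
        V < interceptTime (β i) u (d i) := by
    intro τ
    have hτ : 0 < 1 + τ ^ 2 := by positivity
    refine ⟨((1 - τ ^ 2) / (1 + τ ^ 2)) • w + (2 * τ / (1 + τ ^ 2)) • (Complex.I * w), ?_, ?_⟩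
    · have h := (norm_eq_one_iff w).1 hw.1
      rw [norm_eq_one_iff]
      simp only [Complex.add_re, Complex.add_im, Complex.smul_re, Complex.smul_im,
        Complex.I_mul_re, Complex.I_mul_im, smul_eq_mul]
      field_simp
      linear_combination (1 + τ ^ 2) ^ 2 * h
    · intro i hi
      rw [lt_interceptTime_iff_sq_lt (hβ i) _ _ hV, inner_add_left, inner_smul_left,
        inner_smul_left]
      simp only [conj_trivial]
      have h1 : gain (β i) * ((1 - τ ^ 2) / (1 + τ ^ 2) * inner ℝ w (d i) +
          2 * τ / (1 + τ ^ 2) * inner ℝ (Complex.I * w) (d i)) =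
          a i + 2 * (τ * b i - τ ^ 2 * a i) / (1 + τ ^ 2) := by
        simp only [ha, hb]
        field_simp
        ring
      rw [h1]
      have h2 : 0 < (4 * V * (τ * b i - τ ^ 2 * a i) + e i * (1 + τ ^ 2)) / (1 + τ ^ 2) := by
        positivity
      have h3 : (4 * V * (τ * b i - τ ^ 2 * a i) + e i * (1 + τ ^ 2)) / (1 + τ ^ 2) =
          2 * V * (2 * (τ * b i - τ ^ 2 * a i) / (1 + τ ^ 2)) + e i := by
        field_simp
        ring
      rw [h3] at h2
      simp only [he] at h2
      linarith
  obtain ⟨μ₀, μ₁, h0, h1, hs, hbs, has, hz0, hz1⟩ := exists_multiplier_of_forall_not_lt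
    hV (he0 0) (he0 1) hmin (a₀ := a 0) (b₀ := b 0) (a₁ := a 1) (b₁ := b 1) (fun τ h h' => by
      obtain ⟨u, hu, hi⟩ := rot τ
      exact absurd (lt_min (hi 0 h) (hi 1 h')) (not_lt.2 (survival_le_value hu)))
  refine ⟨![μ₀, μ₁], μ₀ * a 0 + μ₁ * a 1, ?_, by simpa using hs, has, ?_, ?_⟩
  · intro i
    fin_cases i
    · simpa using h0
    · simpa using h1
  · have h := (norm_eq_one_iff w).1 hw.1
    simp only [ha, hb, inner_eq] at hbs ⊢
    simp at hbs ⊢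
    -- the vector is recovered from its components along `w` and `i w`
    apply Complex.ext
    · simp
      linear_combination (-w.im) * hbs - (μ₀ * gain (β 0) * (d 0).re +
        μ₁ * gain (β 1) * (d 1).re) * h
    · simp
      linear_combination w.re * hbs - (μ₀ * gain (β 0) * (d 0).im +
        μ₁ * gain (β 1) * (d 1).im) * h
  · intro i
    fin_cases i
    · exact fun h => act 0 (hz0 (by simpa using h))
    · exact fun h => act 1 (hz1 (by simpa using h))

namespace IsMultiplier
variable {μ : Fin 2 → ℝ} {m : ℝ}

lemma inner_center (h : IsMultiplier β d w μ m) (u : ℂ) :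
    μ 0 * (gain (β 0) * inner ℝ u (d 0)) + μ 1 * (gain (β 1) * inner ℝ u (d 1)) =
      m * inner ℝ u w := by
  have := congrArg (inner ℝ u) h.center
  rw [inner_add_right, inner_smul_right, inner_smul_right, inner_smul_right] at this
  linarith

lemma active_sq (hβ : ∀ i, 1 < β i) (h : IsMultiplier β d w μ m) (i : Fin 2) :
    μ i * value β d ^ 2 =
      μ i * (2 * value β d * (gain (β i) * inner ℝ w (d i)) + gain (β i) * ‖d i‖ ^ 2) := by
  by_cases hi : μ i = 0
  · simp [hi]
  · rw [← h.active i hi, interceptTime_sq (hβ i)]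

lemma value_sq (hβ : ∀ i, 1 < β i) (hw : ‖w‖ = 1) (h : IsMultiplier β d w μ m) :
    value β d ^ 2 = 2 * value β d * m +
      (μ 0 * (gain (β 0) * ‖d 0‖ ^ 2) + μ 1 * (gain (β 1) * ‖d 1‖ ^ 2)) := by
  have h1 := h.inner_center w
  rw [inner_mul_self hw] at h1
  linear_combination h.active_sq hβ 0 + h.active_sq hβ 1 + 2 * value β d * h1 -
    value β d ^ 2 * h.sum_eq

lemma scale_lt_value (hβ : ∀ i, 1 < β i) (hd : ∀ i, d i ≠ 0) (hw : ‖w‖ = 1)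
    (h : IsMultiplier β d w μ m) : m < value β d := by
  have hV := value_pos hβ hd
  have h1 := h.value_sq hβ hw
  have hp : ∀ i, 0 < gain (β i) * ‖d i‖ ^ 2 := fun i => by
    have := gain_pos (hβ i)
    have := hd i
    positivity
  have h2 : 0 < μ 0 * (gain (β 0) * ‖d 0‖ ^ 2) + μ 1 * (gain (β 1) * ‖d 1‖ ^ 2) := by
    have hs := h.sum_eq
    rcases (h.nonneg 0).eq_or_lt with h0 | h0
    · have : μ 1 = 1 := by linarith
      rw [← h0, this]
      linarith [hp 1]
    · linarith [mul_pos h0 (hp 0), mul_nonneg (h.nonneg 1) (hp 1).le]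
  nlinarith [h.scale_nonneg]

/-- The best direction is unique, except for the reflection in the line through the three players
when they are collinear. -/
lemma eq_or_eq_reflect (hβ : ∀ i, 1 < β i) (hd : ∀ i, d i ≠ 0) (hw : ‖w‖ = 1)
    (h : IsMultiplier β d w μ m) (hu : IsBest β d u) :
    u = w ∨ Parallel d ∧ u = reflect (d 0) w := by
  have hV := value_pos hβ hd
  set V := value β d
  have h0 := mul_le_mul_of_nonneg_left (hu.sq_le hβ 0) (h.nonneg 0)
  have h1 := mul_le_mul_of_nonneg_left (hu.sq_le hβ 1) (h.nonneg 1)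
  have hc := h.inner_center u
  have hs := h.value_sq hβ hw
  have hsum : μ 0 * V ^ 2 + μ 1 * V ^ 2 = V ^ 2 := by rw [← add_mul, h.sum_eq, one_mul]
  have hm : 2 * V * m ≤ 2 * V * (m * inner ℝ u w) := by
    rw [← hc]
    linarith
  have hm' : m ≤ m * inner ℝ u w := le_of_mul_le_mul_left hm (by positivity)
  rcases h.scale_nonneg.eq_or_lt with h00 | hpos
  swap
  · exact Or.inl (eq_of_one_le_inner hu.1 hw (by nlinarith))
  -- the combination of the centers is zero: the Pursuers are on opposite sides of the Evader
  have hz := h.center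
  rw [← h00, zero_smul] at hz
  have hg := fun i => gain_pos (hβ i)
  have hsum1 := h.sum_eq
  have hμ0 : 0 < μ 0 := by
    refine (h.nonneg 0).lt_of_ne fun h0 => ?_
    rw [← h0, zero_mul, zero_smul, zero_add, show μ 1 = 1 by linarith, one_mul] at hz
    exact (smul_ne_zero (hg 1).ne' (hd 1)) hz
  have hμ1 : 0 < μ 1 := by
    refine (h.nonneg 1).lt_of_ne fun h0 => ?_
    rw [← h0, zero_mul, zero_smul, add_zero, show μ 0 = 1 by linarith, one_mul] at hz
    exact (smul_ne_zero (hg 0).ne' (hd 0)) hz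
  have heq : inner ℝ u (d 0) = inner ℝ w (d 0) := by
    have e0 := h.active_sq hβ 0
    have e1 := h.active_sq hβ 1
    have hcw := h.inner_center w
    rw [← h00, zero_mul] at hc hcw
    have hle0 : μ 0 * (gain (β 0) * inner ℝ w (d 0)) ≤ μ 0 * (gain (β 0) * inner ℝ u (d 0)) := by
      refine le_of_mul_le_mul_left (a := 2 * V) ?_ (by positivity)
      linarith
    have hle1 : μ 1 * (gain (β 1) * inner ℝ w (d 1)) ≤ μ 1 * (gain (β 1) * inner ℝ u (d 1)) := by
      refine le_of_mul_le_mul_left (a := 2 * V) ?_ (by positivity)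
      linarith
    have : μ 0 * (gain (β 0) * inner ℝ u (d 0)) = μ 0 * (gain (β 0) * inner ℝ w (d 0)) := by
      linarith
    exact mul_left_cancel₀ (hg 0).ne' (mul_left_cancel₀ hμ0.ne' this)
  rcases TwoCutters.eq_or_eq_reflect (hd 0) (hu.1.trans hw.symm) heq with h' | h'
  · exact Or.inl h'
  · refine Or.inr ⟨?_, h'⟩
    have h2 := congrArg (fun z => ((starRingEnd ℂ) (d 0) * z).im) hz
    simp at h2
    have h3 : μ 1 * gain (β 1) * ((starRingEnd ℂ) (d 0) * d 1).im = 0 := by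
      simp only [Complex.mul_im, Complex.conj_re, Complex.conj_im]
      linear_combination h2
    exact (mul_eq_zero.1 h3).resolve_left (mul_pos hμ1 (hg 1)).ne'

end IsMultiplier

/-! ### Rate of change of the value along a motion -/

lemma sub_le_of_ae_hasDerivAt_le {f : ℝ → ℝ} {L : NNReal} (hf : LipschitzWith L f) {a b m : ℝ}
    (hab : a ≤ b) (h : ∀ᵐ t : ℝ, t ∈ Ioo a b → ∀ f', HasDerivAt f f' t → f' ≤ m) :
    f b - f a ≤ m * (b - a) := by
  have hac : AbsolutelyContinuousOnInterval f a b :=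
    (hf.lipschitzOnWith (s := uIcc a b)).absolutelyContinuousOnInterval
  have hc : ∫ _ in a..b, m = m * (b - a) := by
    rw [intervalIntegral.integral_const, smul_eq_mul, mul_comm]
  rw [← hac.integral_deriv_eq_sub, ← hc]
  refine intervalIntegral.integral_mono_ae_restrict hab hac.intervalIntegrable_deriv
    intervalIntegrable_const ?_
  have ha : ∀ᵐ t : ℝ, t ≠ a := by simp [ae_iff, measure_singleton]
  have hb : ∀ᵐ t : ℝ, t ≠ b := by simp [ae_iff, measure_singleton]
  rw [EventuallyLE, ae_restrict_iff' measurableSet_Icc]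
  filter_upwards [h, ha, hb, hf.ae_differentiableAt_real] with t ht hta htb hd hmem
  exact ht ⟨hmem.1.lt_of_ne' hta, hmem.2.lt_of_ne htb⟩ _ hd.hasDerivAt

/-- Almost every point of a set of real numbers is approached from the right within the set. -/
lemma ae_frequently_mem_nhdsGT (Z : Set ℝ) : ∀ᵐ t : ℝ, t ∈ Z → ∃ᶠ s in 𝓝[>] t, s ∈ Z := by
  have h : ({t ∈ Z | 𝓝[Z ∩ Ioi t] t = ⊥}).Countable := countable_setOfPred_isolated_right_within
  filter_upwards [h.ae_notMem volume] with t ht htZ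
  rw [frequently_iff_neBot]
  refine ⟨fun hbot => ht ⟨htZ, ?_⟩⟩
  rw [inter_comm, nhdsWithin_inter', ← hbot]
  rfl

/-- Against an Evader that moves in a best direction, the value decreases at most at the rate `1`,
since it is attained in that direction up to first order. -/
lemma neg_one_le_of_hasDerivAt_value (hβ : ∀ i, 1 < β i) {D : ℝ → Fin 2 → ℂ} {t : ℝ}
    {v : Fin 2 → ℂ} (hw : IsBest β (D t) w) (hv : ∀ i, ‖v i‖ = 1)
    (hD : ∀ i, HasDerivAt (fun s => D s i) (w - β i • v i) t) {V' : ℝ}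
    (hV : HasDerivAt (fun s => value β (D s)) V' t) : -1 ≤ V' := by
  obtain ⟨L, hL⟩ := exists_lipschitzWith_value hβ
  set D' : Fin 2 → ℂ := fun i => w - β i • v i with hD'
  have hDt : HasDerivAt D D' t := hasDerivAt_pi.2 hD
  have h1 := hV.tendsto_slope_zero_right
  have h2 : Tendsto (fun h : ℝ => -1 - L * ‖h⁻¹ • (D (t + h) - D t) - D'‖) (𝓝[>] 0)
      (𝓝 (-1 - L * ‖D' - D'‖)) :=
    tendsto_const_nhds.sub ((hDt.tendsto_slope_zero_right.sub_const D').norm.const_mul _)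
  rw [sub_self, norm_zero, mul_zero, sub_zero] at h2
  refine le_of_tendsto_of_tendsto h2 h1 ?_
  filter_upwards [self_mem_nhdsWithin] with h hh
  have hh : 0 < h := hh
  have hstep : value β (D t) - h ≤ value β (D t + h • D') := by
    refine le_trans (le_survival (u := w) fun i => ?_) (survival_le_value hw.1)
    have := interceptTime_sub_le_of_step (hβ i) hw.1 (hv i) (D t i) hh.le
    have := hw.value_le i
    simp only [Pi.add_apply, Pi.smul_apply, hD']
    linarith
  have hlip : value β (D t + h • D') ≤ value β (D (t + h)) +
      L * (h * ‖h⁻¹ • (D (t + h) - D t) - D'‖) := by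
    have h3 := hL.le_add_mul (D t + h • D') (D (t + h))
    have h4 : dist (D t + h • D') (D (t + h)) = h * ‖h⁻¹ • (D (t + h) - D t) - D'‖ := by
      rw [dist_comm, dist_eq_norm, ← Real.norm_of_nonneg hh.le, ← norm_smul,
        Real.norm_of_nonneg hh.le, smul_sub, smul_inv_smul₀ hh.ne', sub_sub]
    rwa [h4] at h3
  rw [smul_eq_mul, ← div_eq_inv_mul, le_div_iff₀ hh]
  linarith

/-- Limits of best directions are best directions. -/
lemma isBest_of_tendsto (hβ : ∀ i, 1 < β i) {δ : ℕ → Fin 2 → ℂ} {ω : ℕ → ℂ}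
    (hω : ∀ n, IsBest β (δ n) (ω n)) (hδ : Tendsto δ atTop (𝓝 d)) (hl : Tendsto ω atTop (𝓝 w)) :
    IsBest β d w := by
  obtain ⟨L, hL⟩ := exists_lipschitzWith_value hβ
  have hc : ∀ f : (Fin 2 → ℂ) → ℂ → ℝ, Continuous (Function.uncurry f) →
      Tendsto (fun n => f (δ n) (ω n)) atTop (𝓝 (f d w)) := fun f hf =>
    (hf.tendsto (d, w)).comp (hδ.prodMk_nhds hl)
  have h1 := hc (survival β) (continuous_survival β)
  have h2 : Tendsto (fun n => value β (δ n)) atTop (𝓝 (value β d)) :=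
    (hL.continuous.tendsto _).comp hδ
  refine isBest_iff.2 ⟨?_, ?_⟩
  · exact tendsto_nhds_unique hl.norm (tendsto_const_nhds.congr fun n => (hω n).1.symm)
  · exact tendsto_nhds_unique h1 (h2.congr fun n => (hω n).value_eq)

/-- If the state is not collinear, or is approached from the right by collinear states, then each
best direction is a limit from the right of best directions. In the collinear case the limit
of best directions may be the mirror image of `w`, and then their mirror images converge to `w`. -/
lemma exists_seq_isBest_tendsto (hβ : ∀ i, 1 < β i) {D : ℝ → Fin 2 → ℂ} {t : ℝ}
    (hD : ContinuousAt D t) (hd : ∀ i, D t i ≠ 0) (hw : IsBest β (D t) w)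
    (hcl : Parallel (D t) → ∃ᶠ s in 𝓝[>] t, Parallel (D s)) :
    ∃ (s : ℕ → ℝ) (ω : ℕ → ℂ), (∀ n, t < s n) ∧ Tendsto s atTop (𝓝 t) ∧
      (∀ n, IsBest β (D (s n)) (ω n)) ∧ Tendsto ω atTop (𝓝 w) := by
  obtain ⟨μ, m, hμ⟩ := hw.exists_isMultiplier hβ hd
  have hfreq : ∃ᶠ s in 𝓝[>] t, Parallel (D t) → Parallel (D s) := by
    by_cases hp : Parallel (D t)
    · exact (hcl hp).mono fun s hs _ => hs
    · exact Eventually.frequently (Eventually.of_forall fun s h => absurd h hp)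
  have hne : ∀ᶠ s in 𝓝[>] t, D s 0 ≠ 0 :=
    (((continuousAt_pi.1 hD 0).eventually_ne (hd 0))).filter_mono nhdsWithin_le_nhds
  obtain ⟨s, hs, hprop⟩ := exists_seq_forall_of_frequently
    (hfreq.and_eventually (hne.and self_mem_nhdsWithin))
  have hst : Tendsto s atTop (𝓝 t) := hs.mono_right nhdsWithin_le_nhds
  choose ω hω using fun n => exists_isBest β (D (s n))
  obtain ⟨a, -, φ, hφ, ha⟩ := (isCompact_sphere (0 : ℂ) 1).tendsto_subseq
    (x := ω) (fun n => by simpa using (hω n).1)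
  have hsφ : Tendsto (s ∘ φ) atTop (𝓝 t) := hst.comp hφ.tendsto_atTop
  have hDφ : Tendsto (fun n => D (s (φ n))) atTop (𝓝 (D t)) := hD.tendsto.comp hsφ
  have ha_best : IsBest β (D t) a := isBest_of_tendsto hβ (fun n => hω (φ n)) hDφ ha
  rcases hμ.eq_or_eq_reflect hβ hd hw.1 ha_best with rfl | ⟨hp, rfl⟩
  · exact ⟨s ∘ φ, ω ∘ φ, fun n => (hprop _).2.2, hsφ, fun n => hω _, ha⟩
  · refine ⟨s ∘ φ, fun n => reflect (D (s (φ n)) 0) (ω (φ n)), fun n => (hprop _).2.2, hsφ,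
      fun n => isBest_reflect (hprop _).2.1 ((hprop _).1 hp) (hω _), ?_⟩
    have h0 : Tendsto (fun n => D (s (φ n)) 0) atTop (𝓝 (D t 0)) := (tendsto_pi_nhds.1 hDφ) 0
    have hc := Complex.continuous_conj
    have := (h0.div ((hc.tendsto _).comp h0) (by simpa using hd 0)).mul ((hc.tendsto _).comp ha)
    have h3 := reflect_reflect (hd 0) w
    rw [reflect] at h3
    rwa [h3] at this

/-- If the Pursuers that are charged by the multipliers aim at the point that the Evader reaches in
a best direction at the time of the value, then the value decreases at least at the rate `1`. -/
lemma le_neg_one_of_hasDerivAt_value (hβ : ∀ i, 1 < β i) {D : ℝ → Fin 2 → ℂ} {t : ℝ}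
    (hd : ∀ i, D t i ≠ 0) {μ : Fin 2 → ℝ} {m : ℝ} (hw : IsBest β (D t) w)
    (hμ : IsMultiplier β (D t) w μ m) {v : Fin 2 → ℂ} (hu : ‖u‖ = 1) (hv : ∀ i, ‖v i‖ = 1)
    (haim : ∀ i, μ i ≠ 0 →
      D t i + value β (D t) • w = (β i * value β (D t)) • v i)
    (hD : ∀ i, HasDerivAt (fun s => D s i) (u - β i • v i) t)
    (hcl : Parallel (D t) → ∃ᶠ s in 𝓝[>] t, Parallel (D s)) {V' : ℝ}
    (hV : HasDerivAt (fun s => value β (D s)) V' t) : V' ≤ -1 := by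
  obtain ⟨s, ω, hs, hst, hω, hωw⟩ :=
    exists_seq_isBest_tendsto hβ (hasDerivAt_pi.2 hD).continuousAt hd hw hcl
  set V := value β (D t) with hVdef
  have hmV : m < V := hμ.scale_lt_value hβ hd hw.1
  have hm := hμ.scale_nonneg
  have hVpos : 0 < V := value_pos hβ hd
  set k : Fin 2 → ℝ := fun i => μ i * gain (β i) with hk
  set q : ℝ → ℂ := fun s => k 0 • D s 0 + k 1 • D s 1 with hq
  set σ : ℝ → ℝ := fun s => k 0 * ‖D s 0‖ ^ 2 + k 1 * ‖D s 1‖ ^ 2 with hσ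
  have hqt : q t = m • w := hμ.center
  set v' : Fin 2 → ℂ := fun i => u - β i • v i with hv'
  have hq' : HasDerivAt q (k 0 • v' 0 + k 1 • v' 1) t :=
    ((hD 0).const_smul (k 0)).add ((hD 1).const_smul (k 1))
  have hσ' : HasDerivAt σ (k 0 * (2 * inner ℝ (D t 0) (v' 0)) +
      k 1 * (2 * inner ℝ (D t 1) (v' 1))) t :=
    ((hD 0).norm_sq.const_mul (k 0)).add ((hD 1).norm_sq.const_mul (k 1))
  set q' := k 0 • v' 0 + k 1 • v' 1
  set σ' := k 0 * (2 * inner ℝ (D t 0) (v' 0)) + k 1 * (2 * inner ℝ (D t 1) (v' 1))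
  have hsV : V ^ 2 = 2 * V * m + σ t := by
    have := hμ.value_sq hβ hw.1
    simp only [hσ, hk]
    linarith
  -- the multipliers bound the value at the later times
  have hdual : ∀ n, value β (D (s n)) ^ 2 ≤
      2 * value β (D (s n)) * inner ℝ (ω n) (q (s n)) + σ (s n) := by
    intro n
    have h0 := mul_le_mul_of_nonneg_left ((hω n).sq_le hβ 0) (hμ.nonneg 0)
    have h1 := mul_le_mul_of_nonneg_left ((hω n).sq_le hβ 1) (hμ.nonneg 1)
    have hsum : μ 0 * value β (D (s n)) ^ 2 + μ 1 * value β (D (s n)) ^ 2 =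
      value β (D (s n)) ^ 2 := by rw [← add_mul, hμ.sum_eq, one_mul]
    simp only [hq, hσ, hk, inner_add_right, inner_smul_right]
    linarith
  have hineq : ∀ n, slope (fun s => value β (D s)) t (s n) * (value β (D (s n)) + V) ≤
      2 * slope (fun s => value β (D s)) t (s n) * inner ℝ (ω n) (q (s n)) +
        2 * V * inner ℝ (ω n) (slope q t (s n)) + slope σ t (s n) := by
    intro n
    have hpos : 0 < s n - t := sub_pos.2 (hs n)
    have hle : inner ℝ (ω n) (q t) ≤ m := by
      rw [hqt, inner_smul_right]
      have := real_inner_le_norm (ω n) w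
      rw [(hω n).1, hw.1, mul_one] at this
      nlinarith
    simp only [slope_def_module, inner_smul_right, smul_eq_mul, inner_sub_right]
    have hd := hdual n
    rw [← mul_le_mul_iff_of_pos_left hpos]
    have e1 : (s n - t) * ((s n - t)⁻¹ * (value β (D (s n)) - value β (D t)) *
        (value β (D (s n)) + V)) = value β (D (s n)) ^ 2 - V ^ 2 := by
      rw [← hVdef]
      field_simp
      ring
    have e2 : (s n - t) * (2 * ((s n - t)⁻¹ * (value β (D (s n)) - value β (D t))) *
        inner ℝ (ω n) (q (s n)) + 2 * V * ((s n - t)⁻¹ * (inner ℝ (ω n) (q (s n)) -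
        inner ℝ (ω n) (q t))) + (s n - t)⁻¹ * (σ (s n) - σ t)) =
        2 * (value β (D (s n)) - V) * inner ℝ (ω n) (q (s n)) +
        2 * V * (inner ℝ (ω n) (q (s n)) - inner ℝ (ω n) (q t)) + (σ (s n) - σ t) := by
      rw [← hVdef]
      field_simp
    rw [e1, e2]
    nlinarith [mul_le_mul_of_nonneg_left hle hVpos.le]
  have hs' : Tendsto s atTop (𝓝[≠] t) :=
    tendsto_nhdsWithin_iff.2 ⟨hst, Eventually.of_forall fun n => (hs n).ne'⟩
  have l1 := hV.tendsto_slope.comp hs'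
  have l2 := hq'.tendsto_slope.comp hs'
  have l3 := hσ'.tendsto_slope.comp hs'
  have l4 : Tendsto (fun n => value β (D (s n))) atTop (𝓝 V) := hV.continuousAt.tendsto.comp hst
  have l5 : Tendsto (fun n => q (s n)) atTop (𝓝 (q t)) := hq'.continuousAt.tendsto.comp hst
  have hlim := le_of_tendsto_of_tendsto' (l1.mul (l4.add_const V))
    ((((l1.const_mul 2).mul (hωw.inner l5)).add ((hωw.inner l2).const_mul (2 * V))).add l3) hineq
  rw [hqt, inner_smul_right, inner_mul_self hw.1, mul_one] at hlim
  -- the derivative of the dual bound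
  have hterm : ∀ i, k i * (V * inner ℝ w (v' i) + inner ℝ (D t i) (v' i)) =
      k i * (inner ℝ (D t i) u + V * inner ℝ w u) - V * (μ i * (gain (β i) + 1)) := by
    intro i
    by_cases hi : μ i = 0
    · simp [hk, hi]
    · have h1 : V * inner ℝ w (v' i) + inner ℝ (D t i) (v' i) =
          inner ℝ (D t i + V • w) u - β i * inner ℝ (D t i + V • w) (v i) := by
        simp only [hv', inner_sub_right, inner_add_left, inner_smul_left, inner_smul_right,
          conj_trivial]
        ring
      have h2 : inner ℝ (D t i + V • w) (v i) = β i * V := by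
        rw [haim i hi, inner_smul_left, inner_mul_self (hv i)]
        simp
      rw [h1, h2, inner_add_left, inner_smul_left, conj_trivial, ← gain_mul (hβ i)]
      simp only [hk]
      ring
  have hqu : k 0 * inner ℝ (D t 0) u + k 1 * inner ℝ (D t 1) u = m * inner ℝ w u := by
    have := congrArg (fun z => inner ℝ z u) hqt
    simp only [hq, inner_add_left, inner_smul_left, conj_trivial] at this
    exact this
  have hq'w : inner ℝ w q' = k 0 * inner ℝ w (v' 0) + k 1 * inner ℝ w (v' 1) := by
    rw [inner_add_right, inner_smul_right, inner_smul_right]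
  have hkpos : ∀ i, 0 ≤ k i := fun i => mul_nonneg (hμ.nonneg i) (gain_pos (hβ i)).le
  have hwu : inner ℝ w u ≤ 1 := by
    have := real_inner_le_norm w u
    rwa [hw.1, hu, mul_one] at this
  have hrate : V * inner ℝ w q' + σ' / 2 = (m + (k 0 + k 1) * V) * inner ℝ w u -
      V * (k 0 + k 1 + 1) := by
    rw [hq'w]
    have h0 := hterm 0
    have h1 := hterm 1
    have hsum := hμ.sum_eq
    simp only [σ']
    simp only [hk] at h0 h1 hqu ⊢
    linear_combination h0 + h1 + hqu - V * hsum
  have hbound : (m + (k 0 + k 1) * V) * inner ℝ w u ≤ m + (k 0 + k 1) * V := by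
    have : 0 ≤ m + (k 0 + k 1) * V := by
      have := hkpos 0
      have := hkpos 1
      positivity
    nlinarith
  have hfin : (V - m) * V' ≤ (V - m) * (-1) := by linarith
  exact le_of_mul_le_mul_left hfin (sub_pos.2 hmV)

end Directions

/-! ### The feedback in terms of best directions -/

section Play

/-- The vectors from the Pursuers to the Evader. -/
def sight (x : State) (i : Fin 2) : ℂ := x.E - x.P i

variable {β : Fin 2 → ℝ} {x x₀ : State}

lemma sight_ne_zero (hx : ¬ Captured x) (i : Fin 2) : sight x i ≠ 0 := fun h =>
  hx ⟨i, (sub_eq_zero.1 h).symm⟩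

lemma captured_iff_value_eq_zero (hβ : ∀ i, 1 < β i) (x : State) :
    Captured x ↔ value β (sight x) = 0 := by
  constructor
  · rintro ⟨i, hi⟩
    exact value_eq_zero (i := i) hβ (by rw [sight, hi, sub_self])
  · intro h
    by_contra hx
    exact (value_pos hβ (sight_ne_zero hx)).ne' h

lemma norm_heading (θ : ℝ) : ‖heading θ‖ = 1 := by
  rw [norm_eq_one_iff]
  exact Real.cos_sq_add_sin_sq θ

lemma norm_smul_heading_arg (z : ℂ) : ‖z‖ • heading (Complex.arg z) = z := by
  apply Complex.ext
  · simp [heading]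
  · simp [heading]

lemma heading_eq_of_angle_eq {θ θ' : ℝ} (h : (θ : Real.Angle) = θ') : heading θ = heading θ' := by
  apply Complex.ext
  · exact congrArg Real.Angle.cos h
  · exact congrArg Real.Angle.sin h

lemma angle_eq_of_heading_eq {θ θ' : ℝ} (h : heading θ = heading θ') :
    (θ : Real.Angle) = θ' := by
  have hc := congrArg Complex.re h
  have hs := congrArg Complex.im h
  exact Real.Angle.cos_sin_inj hc hs

lemma heading_arg_smul {w : ℂ} (hw : ‖w‖ = 1) {s : ℝ} (hs : 0 < s) :
    heading (Complex.arg (s • w)) = w := by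
  have h := norm_smul_heading_arg (s • w)
  rw [norm_smul, hw, mul_one, Real.norm_of_nonneg hs.le] at h
  exact smul_right_injective ℂ hs.ne' h

lemma sight_eq_smul (x : State) (i : Fin 2) : sight x i = r x i • heading (los x i) :=
  (norm_smul_heading_arg _).symm

lemma r_pos (hx : ¬ Captured x) (i : Fin 2) : 0 < r x i := norm_pos_iff.2 (sight_ne_zero hx i)

lemma tf_eq (β : Fin 2 → ℝ) (x : State) (i : Fin 2) (φ : ℝ) :
    tf β x i φ = interceptTime (β i) (heading φ) (sight x i) := by
  have h : inner ℝ (heading φ) (sight x i) = r x i * Real.cos (φ - los x i) := by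
    rw [sight_eq_smul, inner_smul_right, inner_eq, Real.cos_sub]
    rfl
  have hn : ‖sight x i‖ = r x i := rfl
  simp only [tf, interceptTime, h, hn, c, gain]
  congr 1
  · ring
  · congr 1
    ring

lemma tf_los (hβ : ∀ i, 1 < β i) (hx : ¬ Captured x) (i : Fin 2) :
    tf β x i (los x i) = r x i / (β i - 1) := by
  rw [tf_eq, sight_eq_smul, interceptTime_smul_self (hβ i) (norm_heading _) (r_pos hx i)]

namespace SinglePursuerCase
variable {i : Fin 2}

lemma isBest (hβ : ∀ i, 1 < β i) (hx : ¬ Captured x) (h : SinglePursuerCase β x i) :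
    IsBest β (sight x) (heading (los x i)) ∧ value β (sight x) = tf β x i (los x i) := by
  have hs : survival β (sight x) (heading (los x i)) = tf β x i (los x i) := by
    refine le_antisymm ((survival_le _ _ _ i).trans_eq (tf_eq _ _ _ _).symm)
      (le_survival fun j => ?_)
    rw [← tf_eq]
    by_cases hj : j = i
    · rw [hj]
    · exact h j hj
  have hb : IsBest β (sight x) (heading (los x i)) := by
    refine ⟨norm_heading _, fun u hu => ?_⟩
    rw [hs, tf_eq]
    refine (survival_le _ _ _ i).trans ?_
    rw [sight_eq_smul]
    exact interceptTime_le_smul_self (hβ i) (norm_heading _) hu (r_pos hx i)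
  exact ⟨hb, hb.value_eq.trans hs⟩

lemma value_eq (hβ : ∀ i, 1 < β i) (hx : ¬ Captured x) (h : SinglePursuerCase β x i) :
    value β (sight x) = r x i / (β i - 1) := by
  rw [(h.isBest hβ hx).2, tf_los hβ hx]

lemma isMultiplier (hβ : ∀ i, 1 < β i) (hx : ¬ Captured x) (h : SinglePursuerCase β x i) :
    IsMultiplier β (sight x) (heading (los x i)) (Pi.single i 1) (gain (β i) * r x i) where
  nonneg j := by
    by_cases hj : j = i
    · subst hj; simp
    · simp [hj]
  sum_eq := by fin_cases i <;> simp
  scale_nonneg := (mul_pos (gain_pos (hβ i)) (r_pos hx i)).le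
  center := by
    have := sight_eq_smul x i
    rw [mul_smul (gain (β i)), ← this]
    fin_cases i <;> simp
  active j hj := by
    have : j = i := by
      by_contra hne
      simp [hne] at hj
    subst this
    rw [(h.isBest hβ hx).2, tf_eq]

/-- If the multipliers charge only one Pursuer, then this Pursuer is the only active one. -/
lemma of_isMultiplier (hβ : ∀ i, 1 < β i) {w : ℂ} (hx : ¬ Captured x)
    (hw : IsBest β (sight x) w) {μ : Fin 2 → ℝ} {m : ℝ} (hμ : IsMultiplier β (sight x) w μ m)
    (hz : ∀ j, j ≠ i → μ j = 0) : SinglePursuerCase β x i := by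
  have hμi : μ i = 1 := by
    have := hμ.sum_eq
    obtain rfl | rfl : i = 0 ∨ i = 1 := by omega
    · simpa [hz 1 (by simp)] using this
    · simpa [hz 0 (by simp)] using this
  have hc : gain (β i) • sight x i = m • w := by
    have := hμ.center
    obtain rfl | rfl : i = 0 ∨ i = 1 := by omega
    · simpa [hz 1 (by simp), hμi] using this
    · simpa [hz 0 (by simp), hμi] using this
  have hm : 0 < m := by
    refine hμ.scale_nonneg.lt_of_ne fun h0 => ?_
    rw [← h0, zero_smul] at hc
    exact smul_ne_zero (gain_pos (hβ i)).ne' (sight_ne_zero hx i) hc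
  have hd : sight x i = (m / gain (β i)) • w := by
    rw [div_eq_inv_mul, mul_smul, ← hc, inv_smul_smul₀ (gain_pos (hβ i)).ne']
  have hl : heading (los x i) = w := by
    change heading (Complex.arg (sight x i)) = w
    rw [hd, heading_arg_smul hw.1 (div_pos hm (gain_pos (hβ i)))]
  intro j _
  rw [tf_eq, tf_eq, hl, hμ.active i (by rw [hμi]; exact one_ne_zero)]
  exact hw.value_le j

end SinglePursuerCase

namespace JointCase

lemma isMultiplier_pos (hβ : ∀ i, 1 < β i) {w : ℂ} (hx : ¬ Captured x) (h : JointCase β x)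
    (hw : IsBest β (sight x) w) {μ : Fin 2 → ℝ} {m : ℝ} (hμ : IsMultiplier β (sight x) w μ m)
    (i : Fin 2) : 0 < μ i := by
  refine (hμ.nonneg i).lt_of_ne fun h0 => ?_
  refine h (1 - i) (SinglePursuerCase.of_isMultiplier hβ hx hw hμ fun j hj => ?_)
  have : j = i := by
    revert hj
    fin_cases i <;> fin_cases j <;> simp
  rw [this, h0]

lemma interceptTime_eq (hβ : ∀ i, 1 < β i) {w : ℂ} (hx : ¬ Captured x) (h : JointCase β x)
    (hw : IsBest β (sight x) w) (i : Fin 2) :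
    interceptTime (β i) w (sight x i) = value β (sight x) := by
  obtain ⟨μ, m, hμ⟩ := hw.exists_isMultiplier hβ (sight_ne_zero hx)
  exact hμ.active i (h.isMultiplier_pos hβ hx hw hμ i).ne'

end JointCase

lemma mem_apollonius_iff_norm_sub (β : Fin 2 → ℝ) (x : State) (i : Fin 2) (z : ℂ) :
    x.E + z ∈ apollonius β x i ↔
      ‖z - gain (β i) • sight x i‖ = β i * (gain (β i) * ‖sight x i‖) := by
  have hn : ‖sight x i‖ = r x i := rfl
  have hc : c β x i • heading (los x i) = gain (β i) • sight x i := by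
    rw [sight_eq_smul, smul_smul, c, gain]
    congr 1
    ring
  rw [apollonius, hc, mem_sphere_iff_norm, add_sub_add_left_eq_sub, hn, ρ, gain]
  congr! 1
  ring

/-- The Apollonius circle is the locus of the points whose distances from the Pursuer and the
Evader have the ratio `β i`. -/
lemma mem_apollonius_iff (hβ : ∀ i, 1 < β i) (x : State) (i : Fin 2) (z : ℂ) :
    x.E + z ∈ apollonius β x i ↔ ‖sight x i + z‖ = β i * ‖z‖ := by
  have hg := gain_pos (hβ i)
  have hb : 0 ≤ β i := by linarith [hβ i]
  rw [mem_apollonius_iff_norm_sub, ← sq_eq_sq₀ (norm_nonneg _) (by positivity),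
    ← sq_eq_sq₀ (norm_nonneg _) (by positivity), norm_sub_sq_real, norm_add_sq_real,
    inner_smul_right, norm_smul, Real.norm_of_nonneg hg.le, real_inner_comm (sight x i) z]
  have h := gain_mul (hβ i)
  constructor
  · intro h'
    refine mul_left_cancel₀ hg.ne' ?_
    linear_combination (-1 : ℝ) * h' - (‖z‖ ^ 2 + gain (β i) * ‖sight x i‖ ^ 2) * h
  · intro h'
    linear_combination (-gain (β i)) * h' - (‖z‖ ^ 2 + gain (β i) * ‖sight x i‖ ^ 2) * h

lemma mem_circles_iff (hβ : ∀ i, 1 < β i) (hx : ¬ Captured x) (J : ℂ) :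
    J ∈ apollonius β x 0 ∩ apollonius β x 1 ↔ ∃ (u : ℂ) (τ : ℝ), ‖u‖ = 1 ∧ 0 < τ ∧
      J = x.E + τ • u ∧ ∀ i, interceptTime (β i) u (sight x i) = τ := by
  constructor
  · intro hJ
    obtain ⟨z, rfl⟩ : ∃ z, J = x.E + z := ⟨J - x.E, by ring⟩
    rw [mem_inter_iff, mem_apollonius_iff hβ, mem_apollonius_iff hβ] at hJ
    have hz : z ≠ 0 := by
      rintro rfl
      exact sight_ne_zero hx 0 (by simpa using hJ.1)
    have hz' : 0 < ‖z‖ := norm_pos_iff.2 hz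
    have hzu : ‖z‖ • (‖z‖⁻¹ • z) = z := smul_inv_smul₀ hz'.ne' z
    have hu : ‖‖z‖⁻¹ • z‖ = 1 := by
      rw [norm_smul, norm_inv, norm_norm, inv_mul_cancel₀ hz'.ne']
    refine ⟨‖z‖⁻¹ • z, ‖z‖, hu, hz', by rw [hzu], fun i => ?_⟩
    refine interceptTime_eq_of_norm (hβ i) hu _ hz' ?_
    rw [hzu]
    fin_cases i
    · exact hJ.1
    · exact hJ.2
  · rintro ⟨u, τ, hu, hτ, rfl, h⟩
    have : ∀ i, x.E + τ • u ∈ apollonius β x i := by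
      intro i
      rw [mem_apollonius_iff hβ, norm_smul, hu, Real.norm_of_nonneg hτ.le, mul_one, ← h i]
      exact norm_add_interceptTime (hβ i) hu _
    exact ⟨this 0, this 1⟩

lemma JointCase.mem_circles (hβ : ∀ i, 1 < β i) {w : ℂ} (hx : ¬ Captured x) (h : JointCase β x)
    (hw : IsBest β (sight x) w) :
    x.E + value β (sight x) • w ∈ apollonius β x 0 ∩ apollonius β x 1 :=
  (mem_circles_iff hβ hx _).2 ⟨w, _, hw.1, value_pos hβ (sight_ne_zero hx), rfl,
    h.interceptTime_eq hβ hx hw⟩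

lemma dist_add_smul {E w : ℂ} (hw : ‖w‖ = 1) {s : ℝ} (hs : 0 ≤ s) : dist (E + s • w) E = s := by
  rw [dist_eq_norm, add_sub_cancel_left, norm_smul, hw, mul_one, Real.norm_of_nonneg hs]

/-- The aim points are the points that the Evader reaches in the best directions at the time of the
value. -/
lemma JointCase.mem_aimPoints_iff (hβ : ∀ i, 1 < β i) (hx : ¬ Captured x) (h : JointCase β x)
    (I : ℂ) :
    I ∈ aimPoints β x ↔ ∃ w, IsBest β (sight x) w ∧ I = x.E + value β (sight x) • w := by
  have hmax : ∀ J ∈ apollonius β x 0 ∩ apollonius β x 1, dist J x.E ≤ value β (sight x) := by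
    intro J hJ
    obtain ⟨u, τ, hu, hτ, rfl, hi⟩ := (mem_circles_iff hβ hx J).1 hJ
    rw [dist_add_smul hu hτ.le]
    exact (le_survival fun i => (hi i).ge).trans (survival_le_value hu)
  have hV := value_nonneg hβ (sight x)
  constructor
  · rintro ⟨hI, hfar⟩
    obtain ⟨w, hw⟩ := exists_isBest β (sight x)
    have h1 := hfar _ (h.mem_circles hβ hx hw)
    have h2 := hmax I hI
    obtain ⟨u, τ, hu, hτ, rfl, hi⟩ := (mem_circles_iff hβ hx I).1 hI
    rw [dist_add_smul hw.1 hV, dist_add_smul hu hτ.le] at h1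
    rw [dist_add_smul hu hτ.le] at h2
    have hτV : τ = value β (sight x) := le_antisymm h2 h1
    refine ⟨u, isBest_iff.2 ⟨hu, ?_⟩, by rw [hτV]⟩
    rw [survival, hi, hi, min_self, hτV]
  · rintro ⟨w, hw, rfl⟩
    refine ⟨h.mem_circles hβ hx hw, fun J hJ => ?_⟩
    rw [dist_add_smul hw.1 hV]
    exact hmax J hJ

lemma not_jointCase_iff : ¬ JointCase β x ↔ ∃ i, SinglePursuerCase β x i := by
  simp only [JointCase, not_forall, not_not]

lemma EvaderOptimal.isBest (hβ : ∀ i, 1 < β i) (hx : ¬ Captured x) {φ : ℝ}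
    (h : EvaderOptimal β x φ) : IsBest β (sight x) (heading φ) := by
  by_cases hj : JointCase β x
  · obtain ⟨I, hI, hφ⟩ := h.2 hj
    obtain ⟨w, hw, rfl⟩ := (hj.mem_aimPoints_iff hβ hx I).1 hI
    rwa [heading_eq_of_angle_eq hφ, add_sub_cancel_left,
      heading_arg_smul hw.1 (value_pos hβ (sight_ne_zero hx))]
  · obtain ⟨i, hi⟩ := not_jointCase_iff.1 hj
    rw [heading_eq_of_angle_eq (h.1 i hi)]
    exact (hi.isBest hβ hx).1

/-- A point on both Apollonius circles is reached by the Pursuers, when they aim at it, at the same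
time as by the Evader. -/
lemma JointCase.smul_heading_aim (hβ : ∀ i, 1 < β i) (hx : ¬ Captured x) (h : JointCase β x)
    {w : ℂ} (hw : IsBest β (sight x) w) (i : Fin 2) :
    (β i * value β (sight x)) •
      heading (Complex.arg (x.E + value β (sight x) • w - x.P i)) =
      sight x i + value β (sight x) • w := by
  have h1 : x.E + value β (sight x) • w - x.P i = sight x i + value β (sight x) • w := by
    rw [sight]; ring
  have h2 := norm_add_interceptTime (hβ i) hw.1 (sight x i)
  rw [h.interceptTime_eq hβ hx hw i] at h2
  rw [h1, ← h2, norm_smul_heading_arg]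

lemma PursuersOptimal.exists_isMultiplier (hβ : ∀ i, 1 < β i) (hx : ¬ Captured x)
    {ψ : Fin 2 → ℝ} (h : PursuersOptimal β x ψ) :
    ∃ w μ m, IsBest β (sight x) w ∧ IsMultiplier β (sight x) w μ m ∧ ∀ i, μ i ≠ 0 →
      sight x i + value β (sight x) • w = (β i * value β (sight x)) • heading (ψ i) := by
  by_cases hj : JointCase β x
  · obtain ⟨I, hI, hψ⟩ := h.2 hj
    obtain ⟨w, hw, rfl⟩ := (hj.mem_aimPoints_iff hβ hx I).1 hI
    obtain ⟨μ, m, hμ⟩ := hw.exists_isMultiplier hβ (sight_ne_zero hx)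
    refine ⟨w, μ, m, hw, hμ, fun i _ => ?_⟩
    rw [heading_eq_of_angle_eq (hψ i), hj.smul_heading_aim hβ hx hw]
  · obtain ⟨i, hi⟩ := not_jointCase_iff.1 hj
    refine ⟨_, _, _, (hi.isBest hβ hx).1, hi.isMultiplier hβ hx, fun j hμj => ?_⟩
    have : j = i := by
      by_contra hne
      simp [hne] at hμj
    subst this
    rw [heading_eq_of_angle_eq (h.1 j hi), sight_eq_smul, ← add_smul, hi.value_eq hβ hx]
    congr 1
    have : β j - 1 ≠ 0 := by linarith [hβ j]
    field_simp
    ring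

/-- In the joint case the second intersection point of the circles is the mirror image of an aim
point in the line through the two centers, which does not contain the aim point. -/
lemma JointCase.exists_circles_eq_pair (hβ : ∀ i, 1 < β i) (hx : ¬ Captured x)
    (h : JointCase β x) :
    ∃ I I' : ℂ, I ≠ I' ∧ apollonius β x 0 ∩ apollonius β x 1 = {I, I'} := by
  obtain ⟨w, hw⟩ := exists_isBest β (sight x)
  obtain ⟨μ, m, hμ⟩ := hw.exists_isMultiplier hβ (sight_ne_zero hx)
  set V := value β (sight x) with hV
  have hmV : m < V := hμ.scale_lt_value hβ (sight_ne_zero hx) hw.1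
  set q : Fin 2 → ℂ := fun i => gain (β i) • sight x i with hq
  have hmem := h.mem_circles hβ hx hw
  have hcenter : q 0 + μ 1 • (q 1 - q 0) = m • w := by
    have h1 := hμ.center
    have h2 : μ 0 = 1 - μ 1 := by linarith [hμ.sum_eq]
    rw [mul_smul, mul_smul, h2] at h1
    rw [← h1]
    simp only [hq]
    module
  -- a center that is a real multiple of `w` is a negative multiple
  have hneg : ∀ i (s : ℝ), q i = s • w → s < 0 := by
    intro i s hs
    by_contra! hc
    have hg := gain_pos (hβ i)
    have hspos : 0 < s := hc.lt_of_ne fun h0 => by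
      rw [← h0, zero_smul] at hs
      exact smul_ne_zero hg.ne' (sight_ne_zero hx i) hs
    have hd : sight x i = (s / gain (β i)) • w := by
      rw [div_eq_inv_mul, mul_smul, ← hs, hq, inv_smul_smul₀ hg.ne']
    have hl : heading (los x i) = w := by
      change heading (Complex.arg (sight x i)) = w
      rw [hd, heading_arg_smul hw.1 (div_pos hspos hg)]
    refine h i fun j _ => ?_
    rw [tf_eq, tf_eq, hl, h.interceptTime_eq hβ hx hw, h.interceptTime_eq hβ hx hw]
  have hne : q 1 - q 0 ≠ 0 := by
    intro h0
    rw [h0, smul_zero, add_zero] at hcenter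
    exact (hneg 0 m hcenter).not_ge hμ.scale_nonneg
  set I' : ℂ := x.E + (q 0 + reflect (q 1 - q 0) (V • w - q 0)) with hI'
  have hI'mem : I' ∈ apollonius β x 0 ∩ apollonius β x 1 := by
    have h0 := (mem_apollonius_iff_norm_sub β x 0 _).1 hmem.1
    have h1 := (mem_apollonius_iff_norm_sub β x 1 _).1 hmem.2
    have hconj : (starRingEnd ℂ) (q 1 - q 0) ≠ 0 := (map_ne_zero _).2 hne
    constructor
    · rw [hI', mem_apollonius_iff_norm_sub, ← h0]
      change ‖q 0 + _ - q 0‖ = ‖_ - q 0‖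
      rw [add_sub_cancel_left, norm_reflect hne]
    · rw [hI', mem_apollonius_iff_norm_sub, ← h1]
      change ‖q 0 + _ - q 1‖ = ‖_ - q 1‖
      rw [← norm_reflect hne (V • w - q 1)]
      congr 1
      have : V • w - q 1 = (V • w - q 0) - (q 1 - q 0) := by ring
      rw [this]
      simp only [reflect]
      rw [map_sub (starRingEnd ℂ) (V • w - q 0)]
      field_simp
      ring
  have hII' : x.E + V • w ≠ I' := by
    intro heq
    rw [hI', add_right_inj, ← sub_eq_iff_eq_add'] at heq
    have hconj : (starRingEnd ℂ) (q 1 - q 0) ≠ 0 := (map_ne_zero _).2 hne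
    -- then the aim point lies on the line through the centers
    obtain ⟨t, ht⟩ : ∃ t : ℝ, V • w - q 0 = t • (q 1 - q 0) := by
      have h1 : (starRingEnd ℂ) ((V • w - q 0) / (q 1 - q 0)) = (V • w - q 0) / (q 1 - q 0) := by
        rw [map_div₀]
        conv_rhs => rw [heq]
        simp only [reflect]
        field_simp
      obtain ⟨t, ht⟩ := Complex.conj_eq_iff_real.1 h1
      refine ⟨t, ?_⟩
      rw [Complex.real_smul (x := t), ← ht, div_mul_cancel₀ _ hne]
    have hVm : (V - m) • w = (t - μ 1) • (q 1 - q 0) := by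
      rw [sub_smul, sub_smul, ← ht, ← hcenter]
      ring
    have htμ : t - μ 1 ≠ 0 := by
      intro h0
      rw [h0, zero_smul] at hVm
      refine smul_ne_zero (sub_pos.2 hmV).ne' ?_ hVm
      intro h0
      have := hw.1
      rw [h0, norm_zero] at this
      exact zero_ne_one this
    set η := (t - μ 1)⁻¹ * (V - m) with hη
    have hδ : q 1 - q 0 = η • w := by
      rw [hη, mul_smul, hVm, inv_smul_smul₀ htμ]
    have hq0 : q 0 = (m - μ 1 * η) • w := by
      rw [sub_smul, mul_smul, ← hδ, ← hcenter]
      ring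
    have hq1 : q 1 = (m - μ 1 * η + η) • w := by
      rw [add_smul, ← hq0, ← hδ]
      ring
    have n0 := hneg 0 _ hq0
    have n1 := hneg 1 _ hq1
    have := hμ.sum_eq
    have p0 := h.isMultiplier_pos hβ hx hw hμ 0
    have p1 := h.isMultiplier_pos hβ hx hw hμ 1
    -- `m` is a convex combination of these two negative numbers
    nlinarith [mul_neg_of_pos_of_neg p0 n0, mul_neg_of_pos_of_neg p1 n1, hμ.scale_nonneg]
  refine ⟨_, I', hII', Subset.antisymm ?_ ?_⟩
  · intro J hJ
    have hc : x.E + c β x 0 • heading (los x 0) ≠ x.E + c β x 1 • heading (los x 1) := by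
      have hcq : ∀ i, c β x i • heading (los x i) = q i := by
        intro i
        simp only [hq]
        rw [sight_eq_smul, smul_smul, c, gain]
        congr 1
        ring
      rw [hcq, hcq]
      intro h0
      exact hne (sub_eq_zero.2 (add_left_cancel h0).symm)
    exact EuclideanGeometry.eq_of_dist_eq_of_dist_eq_of_finrank_eq_two Complex.finrank_real_complex
      hc hII' hmem.1 hI'mem.1 hJ.1 hmem.2 hI'mem.2 hJ.2
  · rintro J (rfl | rfl)
    · exact hmem
    · exact hI'mem

/-! ### The saddle point property -/

lemma measurable_heading : Measurable heading := by
  have h : heading = fun θ : ℝ => (Real.cos θ : ℂ) + Real.sin θ * Complex.I := by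
    funext θ
    rw [← Complex.mk_eq_add_mul_I]
    rfl
  rw [h]
  exact Continuous.measurable (by fun_prop)

lemma locallyIntegrable_heading {φ : ℝ → ℝ} (hφ : Measurable φ) :
    LocallyIntegrable (fun s => heading (φ s)) volume :=
  (locallyIntegrable_const (1 : ℝ)).mono (measurable_heading.comp hφ).aestronglyMeasurable
    (Eventually.of_forall fun s => by rw [norm_heading]; simp)

/-- The vector from the `i`-th Pursuer to the Evader along a play, extended to all times. -/
noncomputable def sightAlong (β : Fin 2 → ℝ) (x₀ : State) (φ : ℝ → ℝ) (ψ : Fin 2 → ℝ → ℝ) (t : ℝ)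
    (i : Fin 2) : ℂ :=
  sight x₀ i + ((∫ s in (0 : ℝ)..t, heading (φ s)) - β i • ∫ s in (0 : ℝ)..t, heading (ψ i s))

lemma sightAlong_zero (φ : ℝ → ℝ) (ψ : Fin 2 → ℝ → ℝ) : sightAlong β x₀ φ ψ 0 = sight x₀ := by
  funext i
  simp [sightAlong]

lemma IsPlay.sight_eq {T : ℝ} {x : ℝ → State} {φ : ℝ → ℝ} {ψ : Fin 2 → ℝ → ℝ}
    (h : IsPlay β x₀ T x φ ψ) {t : ℝ} (ht : t ∈ Icc 0 T) :
    sight (x t) = sightAlong β x₀ φ ψ t := by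
  funext i
  rw [sight, h.evader t ht, h.pursuer i t ht, sightAlong, sight,
    intervalIntegral.integral_smul]
  ring

lemma ae_hasDerivAt_sightAlong (β : Fin 2 → ℝ) (x₀ : State) {φ : ℝ → ℝ} {ψ : Fin 2 → ℝ → ℝ}
    (hφ : Measurable φ) (hψ : ∀ i, Measurable (ψ i)) :
    ∀ᵐ t : ℝ, ∀ i, HasDerivAt (fun s => sightAlong β x₀ φ ψ s i)
      (heading (φ t) - β i • heading (ψ i t)) t := by
  have h1 := _root_.LocallyIntegrable.ae_hasDerivAt_integral (locallyIntegrable_heading hφ)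
  have h2 := ae_all_iff.2 fun i =>
    _root_.LocallyIntegrable.ae_hasDerivAt_integral (locallyIntegrable_heading (hψ i))
  filter_upwards [h1, h2] with t h1 h2 i
  exact ((h1 0).sub ((h2 i 0).const_smul (β i))).const_add _

lemma exists_lipschitzWith_value_sightAlong (hβ : ∀ i, 1 < β i) (x₀ : State) {φ : ℝ → ℝ}
    {ψ : Fin 2 → ℝ → ℝ} (hφ : Measurable φ) (hψ : ∀ i, Measurable (ψ i)) :
    ∃ L : NNReal, LipschitzWith L fun t => value β (sightAlong β x₀ φ ψ t) := by
  have hint : ∀ {φ : ℝ → ℝ}, Measurable φ →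
      LipschitzWith 1 fun t => ∫ s in (0 : ℝ)..t, heading (φ s) := by
    intro φ hφ
    have hi : ∀ a b, IntervalIntegrable (fun s => heading (φ s)) volume a b := fun a b =>
      intervalIntegrable_iff.2 (((locallyIntegrable_heading hφ).integrableOn_isCompact
        isCompact_uIcc).mono_set uIoc_subset_uIcc)
    refine LipschitzWith.of_dist_le_mul fun a b => ?_
    rw [dist_eq_norm, intervalIntegral.integral_interval_sub_left (hi _ _) (hi _ _),
      dist_comm, Real.dist_eq, abs_sub_comm]
    exact intervalIntegral.norm_integral_le_of_norm_le_const fun s _ => (norm_heading _).le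
  obtain ⟨L, hL⟩ := exists_lipschitzWith_value hβ
  have hcomp : ∀ i, LipschitzWith (1 + ‖β i‖₊) fun t => sightAlong β x₀ φ ψ t i := by
    intro i
    have h := (LipschitzWith.const (sight x₀ i)).add
      ((hint hφ).sub ((lipschitzWith_smul (β i)).comp (hint (hψ i))))
    rw [zero_add, mul_one] at h
    exact h
  have hD : LipschitzWith (∑ i, (1 + ‖β i‖₊)) (sightAlong β x₀ φ ψ) := by
    refine LipschitzWith.of_dist_le_mul fun a b => ?_
    rw [dist_pi_le_iff (by positivity)]
    intro i
    refine ((hcomp i).dist_le_mul a b).trans ?_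
    gcongr
    exact Finset.single_le_sum (f := fun i => 1 + ‖β i‖₊) (fun _ _ => zero_le) (Finset.mem_univ i)
  exact ⟨_, hL.comp hD⟩

lemma isSaddlePoint_value (hβ : ∀ i, 1 < β i) (x₀ : State) :
    IsSaddlePoint β x₀ (value β (sight x₀)) where
  pursuers := by
    intro T x φ ψ hplay hfollow hVT
    by_contra! hnot
    set V := value β (sight x₀) with hVdef
    have hV : 0 ≤ V := value_nonneg hβ _
    obtain ⟨L, hL⟩ := exists_lipschitzWith_value_sightAlong hβ x₀ hplay.measurable_evader
      hplay.measurable_pursuer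
    have key := sub_le_of_ae_hasDerivAt_le hL (m := -1) hV (by
      filter_upwards [hfollow, ae_hasDerivAt_sightAlong β x₀ hplay.measurable_evader
        hplay.measurable_pursuer, ae_frequently_mem_nhdsGT {t | Parallel (sightAlong β x₀ φ ψ t)}]
        with t hopt hder hcl ht f' hf'
      have htT : t ∈ Icc 0 T := ⟨ht.1.le, ht.2.le.trans hVT⟩
      have hx := hnot t ⟨ht.1.le, ht.2.le⟩
      have hsight := hplay.sight_eq htT
      obtain ⟨w, μ, m, hw, hμ, haim⟩ := (hopt htT fun s hs =>
        hnot s ⟨hs.1, hs.2.trans ht.2.le⟩).exists_isMultiplier hβ hx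
      rw [hsight] at hw hμ haim
      exact le_neg_one_of_hasDerivAt_value hβ (fun i => hsight ▸ sight_ne_zero hx i) hw hμ
        (norm_heading (φ t)) (fun i => norm_heading (ψ i t)) haim hder hcl hf')
    rw [sightAlong_zero, ← hVdef, ← hplay.sight_eq ⟨hV, hVT⟩] at key
    have := value_pos hβ (sight_ne_zero (hnot V ⟨hV, le_rfl⟩))
    linarith
  evader := by
    intro T x φ ψ hplay hfollow t ht hcap
    obtain ⟨L, hL⟩ := exists_lipschitzWith_value_sightAlong hβ x₀ hplay.measurable_evader
      hplay.measurable_pursuer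
    -- the first time of capture
    set S : Set ℝ := {s ∈ Icc 0 t | value β (sightAlong β x₀ φ ψ s) = 0} with hS
    have hiff : ∀ s ∈ Icc 0 t, (Captured (x s) ↔ value β (sightAlong β x₀ φ ψ s) = 0) := by
      intro s hs
      rw [captured_iff_value_eq_zero hβ, hplay.sight_eq ⟨hs.1, hs.2.trans ht.2⟩]
    have hSc : IsClosed S := isClosed_Icc.inter (isClosed_singleton.preimage hL.continuous)
    have htt : t ∈ Icc 0 t := ⟨ht.1, le_rfl⟩
    have htS : t ∈ S := ⟨htt, (hiff t htt).1 hcap⟩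
    have hbdd : BddBelow S := ⟨0, fun s hs => hs.1.1⟩
    have hτ : sInf S ∈ S := hSc.csInf_mem ⟨t, htS⟩ hbdd
    have hτt : sInf S ≤ t := csInf_le hbdd htS
    refine le_trans ?_ hτt
    have key := sub_le_of_ae_hasDerivAt_le hL.neg (m := 1) hτ.1.1 (by
      filter_upwards [hfollow, ae_hasDerivAt_sightAlong β x₀ hplay.measurable_evader
        hplay.measurable_pursuer] with s hopt hder hs f' hf'
      have hnot : ∀ a ∈ Icc 0 s, ¬ Captured (x a) := by
        intro a ha hc
        have hat : a ∈ Icc 0 t := ⟨ha.1, ha.2.trans (hs.2.le.trans hτt)⟩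
        exact (csInf_le hbdd ⟨hat, (hiff a hat).1 hc⟩).not_gt (ha.2.trans_lt hs.2)
      have hsT : s ∈ Icc 0 T := ⟨hs.1.le, hs.2.le.trans (hτt.trans ht.2)⟩
      have hw := (hopt hsT hnot).isBest hβ (hnot s ⟨hs.1.le, le_rfl⟩)
      rw [hplay.sight_eq hsT] at hw
      have := neg_one_le_of_hasDerivAt_value hβ hw (fun i => norm_heading (ψ i s)) hder
        (by simpa using hf'.neg)
      linarith)
    simp only [Pi.neg_apply] at key
    rw [sightAlong_zero, hτ.2] at key
    linarith

/-! ### Optimal play -/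

/-- The motion in which all players hold constant headings. -/
noncomputable def straightMotion (β : Fin 2 → ℝ) (x₀ : State) (φ : ℝ) (ψ : Fin 2 → ℝ)
    (t : ℝ) : State where
  E := x₀.E + t • heading φ
  P i := x₀.P i + (β i * t) • heading (ψ i)

lemma isPlay_straightMotion (β : Fin 2 → ℝ) (x₀ : State) (T φ : ℝ) (ψ : Fin 2 → ℝ) :
    IsPlay β x₀ T (straightMotion β x₀ φ ψ) (fun _ => φ) (fun i _ => ψ i) where
  measurable_evader := measurable_const
  measurable_pursuer _ := measurable_const
  evader t _ := by simp [straightMotion]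
  pursuer i t _ := by
    rw [intervalIntegral.integral_const, sub_zero, smul_smul, mul_comm t]
    rfl

lemma straightMotion_zero (β : Fin 2 → ℝ) (x₀ : State) (φ : ℝ) (ψ : Fin 2 → ℝ) :
    straightMotion β x₀ φ ψ 0 = x₀ := by
  simp [straightMotion]

lemma sight_straightMotion (β : Fin 2 → ℝ) (x₀ : State) (φ : ℝ) (ψ : Fin 2 → ℝ) (t : ℝ)
    (i : Fin 2) : sight (straightMotion β x₀ φ ψ t) i =
      sight x₀ i + t • (heading φ - β i • heading (ψ i)) := by
  simp only [sight, straightMotion]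
  module

/-- The line of sight `e` is the only direction in which the interception time reaches its maximum
`τ = s / (b - 1)`, where `s` is the distance to the Pursuer. -/
lemma eq_of_le_interceptTime_smul {b : ℝ} (hb : 1 < b) {e u : ℂ} (he : ‖e‖ = 1) (hu : ‖u‖ = 1)
    {τ : ℝ} (hτ : 0 < τ) (h : τ ≤ interceptTime b u ((τ * (b - 1)) • e)) : u = e := by
  rw [le_interceptTime_iff_sq_le hb _ _ hτ.le, inner_smul_right, norm_smul, he, mul_one,
    Real.norm_of_nonneg (mul_nonneg hτ.le (by linarith)), gain] at h
  have hb' : b ^ 2 - 1 = (b - 1) * (b + 1) := by ring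
  have h1 : 0 < b - 1 := by linarith
  have h2 : 0 < b + 1 := by linarith
  rw [hb'] at h
  have h3 : 2 * τ * (1 / ((b - 1) * (b + 1)) * (τ * (b - 1) * inner ℝ u e)) +
      1 / ((b - 1) * (b + 1)) * (τ * (b - 1)) ^ 2 =
      τ ^ 2 * ((2 * inner ℝ u e + (b - 1)) / (b + 1)) := by
    field_simp
  rw [h3] at h
  have h4 : 1 ≤ (2 * inner ℝ u e + (b - 1)) / (b + 1) := by
    by_contra! hc
    nlinarith [mul_pos (pow_pos hτ 2) (sub_pos.2 hc)]
  rw [le_div_iff₀ h2] at h4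
  exact eq_of_one_le_inner hu he (by linarith)

/-- Strict convexity of the Euclidean norm. -/
lemma eq_of_le_norm_smul_add_smul {u v : ℂ} (hu : ‖u‖ = 1) (hv : ‖v‖ = 1) {s t : ℝ} (hs : 0 < s)
    (ht : 0 < t) (h : s + t ≤ ‖s • u + t • v‖) : u = v := by
  have h1 : (s + t) ^ 2 ≤ ‖s • u + t • v‖ ^ 2 := pow_le_pow_left₀ (by positivity) h 2
  rw [norm_add_sq_real, inner_smul_left, inner_smul_right, norm_smul, norm_smul, hu, hv,
    Real.norm_of_nonneg hs.le, Real.norm_of_nonneg ht.le, conj_trivial] at h1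
  refine eq_of_one_le_inner hu hv ?_
  by_contra! hc
  nlinarith [mul_pos (mul_pos hs ht) (sub_pos.2 hc)]

/-- Along constant headings against a single active Pursuer, this Pursuer remains active. The other
Pursuer can become active as well, but only from straight behind. -/
lemma SinglePursuerCase.straightMotion (hβ : ∀ i, 1 < β i) (hx : ¬ Captured x₀) {i : Fin 2}
    (h : SinglePursuerCase β x₀ i) {φ : ℝ} {ψ : Fin 2 → ℝ} (hopt : OptimalHeadings β x₀ φ ψ) :
    (∀ t ∈ Ico 0 (value β (sight x₀)), ¬ Captured (straightMotion β x₀ φ ψ t) ∧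
      OptimalHeadings β (straightMotion β x₀ φ ψ t) φ ψ) ∧
    (straightMotion β x₀ φ ψ (value β (sight x₀))).P i =
      (straightMotion β x₀ φ ψ (value β (sight x₀))).E := by
  set V := value β (sight x₀) with hVdef
  have hbi : 0 < β i - 1 := by linarith [hβ i]
  have hr := r_pos hx i
  have hVr : V * (β i - 1) = r x₀ i := by
    rw [hVdef, h.value_eq hβ hx]
    field_simp
  have hφi := heading_eq_of_angle_eq (hopt.1 i h).1
  have hψi := heading_eq_of_angle_eq (hopt.1 i h).2
  have hbest := (h.isBest hβ hx).1
  rw [← hφi] at hbest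
  have hsi : ∀ t, sight (TwoCutters.straightMotion β x₀ φ ψ t) i =
      ((V - t) * (β i - 1)) • heading φ := by
    intro t
    rw [sight_straightMotion, sight_eq_smul, ← hφi, hψi, ← hφi, ← hVr]
    module
  constructor
  · intro t ht
    set y := TwoCutters.straightMotion β x₀ φ ψ t with hy
    have hVt : 0 < V - t := sub_pos.2 ht.2
    -- the Evader still reaches the same point before the Pursuers
    have hlb : ∀ j, V - t ≤ interceptTime (β j) (heading φ) (sight y j) := by
      intro j
      rw [hy, sight_straightMotion]
      have := interceptTime_sub_le_of_step (hβ j) (norm_heading φ) (norm_heading (ψ j))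
        (sight x₀ j) ht.1
      linarith [hbest.value_le j]
    have hcap : ¬ Captured y := by
      rintro ⟨j, hj⟩
      have := hlb j
      rw [sight, hj, sub_self, interceptTime_zero] at this
      linarith
    have hlos : heading (los y i) = heading φ := by
      change heading (Complex.arg (sight y i)) = _
      rw [hsi, heading_arg_smul (norm_heading φ) (mul_pos hVt hbi)]
    have hti : tf β y i (los y i) = V - t := by
      rw [tf_eq, hlos, hsi, interceptTime_smul_self (hβ i) (norm_heading φ) (mul_pos hVt hbi)]
      field_simp
    have hsingle : SinglePursuerCase β y i := by
      intro j _
      rw [hti, tf_eq, hlos]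
      exact hlb j
    have hVy : value β (sight y) = V - t := by rw [(hsingle.isBest hβ hcap).2, hti]
    refine ⟨hcap, fun j hj => ?_, fun hjoint => absurd hsingle (hjoint i)⟩
    have hsj : sight y j = ((V - t) * (β j - 1)) • heading (los y j) := by
      have hbj : β j - 1 ≠ 0 := by linarith [hβ j]
      have h1 : V - t = r y j / (β j - 1) := by rw [← hVy, hj.value_eq hβ hcap]
      rw [sight_eq_smul, h1, div_mul_cancel₀ _ hbj]
    have hφj : heading φ = heading (los y j) := by
      refine eq_of_le_interceptTime_smul (hβ j) (norm_heading _) (norm_heading _) hVt ?_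
      rw [← hsj]
      exact hlb j
    refine ⟨angle_eq_of_heading_eq hφj, angle_eq_of_heading_eq ?_⟩
    rcases ht.1.eq_or_lt with h0 | h0
    · rw [hy, ← h0, straightMotion_zero] at hj hφj ⊢
      exact heading_eq_of_angle_eq (hopt.1 j hj).2
    · rw [← hφj]
      have h1 := hbest.value_le j
      rw [le_interceptTime_iff (hβ j) (norm_heading φ) _ (hVt.le.trans (by linarith [ht.1])),
        ← hVdef] at h1
      have h2 := sight_straightMotion β x₀ φ ψ t j
      rw [← hy, hsj, ← hφj] at h2
      have h3 : sight x₀ j + V • heading φ =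
          β j • ((V - t) • heading φ + t • heading (ψ j)) := by
        rw [← sub_eq_iff_eq_add] at h2
        rw [← h2]
        module
      rw [h3, norm_smul, Real.norm_of_nonneg (by linarith [hβ j])] at h1
      have h4 := le_of_mul_le_mul_left h1 (by linarith [hβ j])
      exact (eq_of_le_norm_smul_add_smul (norm_heading _) (norm_heading _) hVt h0
        (by linarith)).symm
  · have := hsi V
    rw [sub_self, zero_mul, zero_smul, sight, sub_eq_zero] at this
    exact this.symm

section Homothety
variable {y : State} {κ : ℝ}

lemma los_eq_of_sight_eq_smul (hκ : 0 < κ) (h : ∀ i, sight y i = κ • sight x i) (i : Fin 2) :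
    los y i = los x i := by
  change Complex.arg (sight y i) = Complex.arg (sight x i)
  rw [h, Complex.real_smul, Complex.arg_real_mul _ hκ]

lemma jointCase_of_sight_eq_smul (hκ : 0 < κ) (h : ∀ i, sight y i = κ • sight x i)
    (hx : JointCase β x) : JointCase β y := by
  intro i hi
  refine hx i fun j hj => ?_
  have h1 := hi j hj
  rw [tf_eq, tf_eq, los_eq_of_sight_eq_smul hκ h, h, h, interceptTime_homogeneous _ _ hκ.le,
    interceptTime_homogeneous _ _ hκ.le] at h1
  rw [tf_eq, tf_eq]
  exact le_of_mul_le_mul_left h1 hκ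

lemma isBest_of_sight_eq_smul (hκ : 0 ≤ κ) (h : ∀ i, sight y i = κ • sight x i) {w : ℂ}
    (hw : IsBest β (sight x) w) :
    IsBest β (sight y) w ∧ value β (sight y) = κ * value β (sight x) := by
  have hs : ∀ u, survival β (sight y) u = κ * survival β (sight x) u := by
    intro u
    simp only [survival, h, interceptTime_homogeneous _ _ hκ, mul_min_of_nonneg _ _ hκ]
  have hb : IsBest β (sight y) w := by
    refine ⟨hw.1, fun u hu => ?_⟩
    rw [hs, hs]
    exact mul_le_mul_of_nonneg_left (hw.2 u hu) hκ
  exact ⟨hb, by rw [hb.value_eq, hs, hw.value_eq]⟩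

end Homothety

/-- In the joint case the state that evolves along optimal constant headings contracts
homothetically to the aim point. -/
lemma JointCase.straightMotion (hβ : ∀ i, 1 < β i) (hx : ¬ Captured x₀) (h : JointCase β x₀)
    {φ : ℝ} {ψ : Fin 2 → ℝ} (hopt : OptimalHeadings β x₀ φ ψ) :
    (∀ t ∈ Ico 0 (value β (sight x₀)), ¬ Captured (straightMotion β x₀ φ ψ t) ∧
      OptimalHeadings β (straightMotion β x₀ φ ψ t) φ ψ) ∧
    (straightMotion β x₀ φ ψ (value β (sight x₀))).E ∈ aimPoints β x₀ ∧
    ∀ i, (straightMotion β x₀ φ ψ (value β (sight x₀))).P i =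
      (straightMotion β x₀ φ ψ (value β (sight x₀))).E := by
  set V := value β (sight x₀) with hVdef
  have hV : 0 < V := value_pos hβ (sight_ne_zero hx)
  obtain ⟨I, hI, hφ, hψ⟩ := hopt.2 h
  obtain ⟨w, hw, rfl⟩ := (h.mem_aimPoints_iff hβ hx I).1 hI
  rw [← hVdef] at hI hφ hψ
  have hφw : heading φ = w := by
    rw [heading_eq_of_angle_eq hφ, add_sub_cancel_left, heading_arg_smul hw.1 hV]
  have hψi : ∀ i, (β i * V) • heading (ψ i) = sight x₀ i + V • w := by
    intro i
    rw [heading_eq_of_angle_eq (hψ i)]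
    exact h.smul_heading_aim hβ hx hw i
  have hs : ∀ t i, sight (TwoCutters.straightMotion β x₀ φ ψ t) i =
      (1 - t / V) • sight x₀ i := by
    intro t i
    have h1 : β i • heading (ψ i) = V⁻¹ • (sight x₀ i + V • w) := by
      rw [← hψi, smul_smul]
      congr 1
      field_simp
    have h2 : w = V⁻¹ • (V • w) := (inv_smul_smul₀ hV.ne' w).symm
    rw [sight_straightMotion, hφw, h1, smul_add, ← h2, div_eq_mul_inv]
    module
  refine ⟨fun t ht => ?_, ?_, fun i => ?_⟩
  · set y := TwoCutters.straightMotion β x₀ φ ψ t with hy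
    have hκ : 0 < 1 - t / V := by
      rw [sub_pos, div_lt_one hV]
      exact ht.2
    have hcap : ¬ Captured y := by
      rintro ⟨i, hi⟩
      have := hs t i
      rw [← hy, sight, hi, sub_self] at this
      exact smul_ne_zero hκ.ne' (sight_ne_zero hx i) this.symm
    have hj : JointCase β y := jointCase_of_sight_eq_smul hκ (hs t) h
    obtain ⟨hwy, hVy⟩ := isBest_of_sight_eq_smul hκ.le (hs t) hw
    rw [← hVdef, ← hy] at hVy
    refine ⟨hcap, fun i hi => absurd hi (hj i), fun _ => ?_⟩
    refine ⟨_, (hj.mem_aimPoints_iff hβ hcap _).2 ⟨w, hwy, rfl⟩, ?_, fun i => ?_⟩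
    · refine angle_eq_of_heading_eq ?_
      rw [add_sub_cancel_left, heading_arg_smul hw.1 (value_pos hβ (sight_ne_zero hcap)), hφw]
    · refine angle_eq_of_heading_eq ?_
      have h1 := hj.smul_heading_aim hβ hcap hwy i
      have hpos : β i * value β (sight y) ≠ 0 :=
        (mul_pos (by linarith [hβ i]) (value_pos hβ (sight_ne_zero hcap))).ne'
      refine smul_right_injective ℂ hpos ?_
      change (β i * value β (sight y)) • _ = (β i * value β (sight y)) • _
      rw [h1, hs t i, hVy, mul_smul (1 - t / V) V w, ← smul_add, ← hψi, smul_smul]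
      congr 1
      ring
  · change x₀.E + V • heading φ ∈ _
    rwa [hφw]
  · have := hs V i
    rw [div_self hV.ne', sub_self, zero_smul, sight, sub_eq_zero] at this
    exact this.symm

lemma exists_optimalHeadings (hβ : ∀ i, 1 < β i) (hx : ¬ Captured x) :
    ∃ (φ : ℝ) (ψ : Fin 2 → ℝ), OptimalHeadings β x φ ψ := by
  by_cases hj : JointCase β x
  · obtain ⟨w, hw⟩ := exists_isBest β (sight x)
    exact ⟨_, fun i => _, fun i hi => absurd hi (hj i),
      fun _ => ⟨_, (hj.mem_aimPoints_iff hβ hx _).2 ⟨w, hw, rfl⟩, rfl, fun i => rfl⟩⟩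
  · obtain ⟨i, hi⟩ := not_jointCase_iff.1 hj
    refine ⟨los x i, los x, fun j h => ⟨angle_eq_of_heading_eq ?_, rfl⟩, fun h => absurd h hj⟩
    -- if both Pursuers are active, then they are in the same direction
    refine eq_of_le_interceptTime_smul (hβ j) (norm_heading _) (norm_heading _)
      (value_pos hβ (sight_ne_zero hx)) ?_
    have hbj : β j - 1 ≠ 0 := by linarith [hβ j]
    have h1 := (hi.isBest hβ hx).1.value_le j
    rw [sight_eq_smul x j] at h1
    rwa [h.value_eq hβ hx, div_mul_cancel₀ _ hbj, ← h.value_eq hβ hx]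

end Play

end TwoCutters

theorem mainTheorem2 (β : Fin 2 → ℝ) (hβ : ∀ i, 1 < β i)
    (x₀ : TwoCutters.State) (hx₀ : ¬ TwoCutters.Captured x₀) :
    -- in the joint case the Apollonius circles meet in exactly two points
    (TwoCutters.JointCase β x₀ →
      ∃ I I' : ℂ, I ≠ I' ∧
        TwoCutters.apollonius β x₀ 0 ∩ TwoCutters.apollonius β x₀ 1 = {I, I'}) ∧
    -- the three cases are consistent and prescribe headings in every state before capture
    (∃ (φ : ℝ) (ψ : Fin 2 → ℝ), TwoCutters.OptimalHeadings β x₀ φ ψ) ∧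
    ∃ V : ℝ, 0 < V ∧
      -- the capture time under optimal play
      (∀ i, TwoCutters.SinglePursuerCase β x₀ i →
        V = TwoCutters.tf β x₀ i (TwoCutters.los x₀ i)) ∧
      (TwoCutters.JointCase β x₀ → ∀ I ∈ TwoCutters.aimPoints β x₀, V = dist I x₀.E ∧
        ∀ i, V = TwoCutters.tf β x₀ i (Complex.arg (I - x₀.E))) ∧
      -- the feedback strategies are a saddle point
      TwoCutters.IsSaddlePoint β x₀ V ∧
      -- optimal play: constant headings that agree with the feedback all the time, capture at `V`
      -- by the active Pursuer, and in the joint case by both Pursuers, at the aim point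
      (∀ (φ : ℝ) (ψ : Fin 2 → ℝ), TwoCutters.OptimalHeadings β x₀ φ ψ →
        ∃ x : ℝ → TwoCutters.State,
          TwoCutters.IsPlay β x₀ V x (fun _ => φ) (fun i _ => ψ i) ∧
          (∀ t ∈ Set.Ico 0 V,
            ¬ TwoCutters.Captured (x t) ∧ TwoCutters.OptimalHeadings β (x t) φ ψ) ∧
          (∀ i, TwoCutters.SinglePursuerCase β x₀ i → (x V).P i = (x V).E) ∧
          (TwoCutters.JointCase β x₀ →
            (x V).E ∈ TwoCutters.aimPoints β x₀ ∧ ∀ i, (x V).P i = (x V).E)) := by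
  open TwoCutters in
  refine ⟨fun h => h.exists_circles_eq_pair hβ hx₀, exists_optimalHeadings hβ hx₀,
    value β (sight x₀), value_pos hβ (sight_ne_zero hx₀),
    fun i hi => (hi.isBest hβ hx₀).2, fun h I hI => ?_, isSaddlePoint_value hβ x₀,
    fun φ ψ hopt => ⟨straightMotion β x₀ φ ψ, isPlay_straightMotion β x₀ _ φ ψ, ?_,
      fun i hi => (hi.straightMotion hβ hx₀ hopt).2,
      fun h => (h.straightMotion hβ hx₀ hopt).2⟩⟩
  · obtain ⟨w, hw, rfl⟩ := (h.mem_aimPoints_iff hβ hx₀ I).1 hI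
    refine ⟨(dist_add_smul hw.1 (value_nonneg hβ _)).symm, fun i => ?_⟩
    rw [tf_eq, add_sub_cancel_left,
      heading_arg_smul hw.1 (value_pos hβ (sight_ne_zero hx₀)), h.interceptTime_eq hβ hx₀ hw]
  · by_cases hj : JointCase β x₀
    · exact (hj.straightMotion hβ hx₀ hopt).1
    · obtain ⟨i, hi⟩ := not_jointCase_iff.1 hj
      exact (hi.straightMotion hβ hx₀ hopt).1
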